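/- Setting. Let $N$ sensor nodes be joined by a connected undirected graph with weight matrix $\mathcal L=[l_{ij}]$: $\mathcal L$ is doubly stochastic, $l_{ii}>0$, and for $i\ne j$ one has $l_{ij}>0$ if $i,j$ are adjacent and $l_{ij}=0$ otherwise. Let $A,Q\in\mathbb R^{n\times n}$, $C_i\in\mathbb R^{m_i\times n}$, $R_i\in\mathbb R^{m_i\times m_i}$ with $Q,R_i>0$ (symmetric positive definite), let $\gamma\ge 1$ be an integer, write $l_{ij}^{(\gamma)}=[\mathcal L^\gamma]_{ij}$, let $\dagger$ denote the Moore–Penrose inverse, and put $$\tilde C_i=\sum_{j=1}^N l_{ij}^{(\gamma)}C_j^TR_j^{-1}C_j,\qquad \tilde R_i=\sum_{j=1}^N \bigl(l_{ij}^{(\gamma)}\bigr)^2C_j^TR_j^{-1}C_j .$$ For initial data $\hat x_0\in\mathbb R^n$, $P_0>0$, factors $Y_i\in\mathbb R^{n\times n}$ with $Y_i^TY_i=C_i^TR_i^{-1}C_i$, and measurements $y_{i,k}\in\mathbb R^{m_i}$ ($k\ge1$), both algorithms start with $\hat x_{i,0|0}=\hat x_0$, $P_{i,0|0}=P_0$,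 and perform at each step $k\ge 1$ $$\hat x_{i,k|k-1}=A\hat x_{i,k-1|k-1},\quad P_{i,k|k-1}=AP_{i,k-1|k-1}A^T+Q,$$ $$P_{i,k|k}=\bigl(P_{i,k|k-1}^{-1}+\tilde C_i^TU_{i,k}^\dagger\tilde C_i\bigr)^{-1},\quad \hat x_{i,k|k}=P_{i,k|k}\bigl(P_{i,k|k-1}^{-1}\hat x_{i,k|k-1}+\tilde C_i^TU_{i,k}^\dagger\tilde y_{i,k}\bigr),$$ where $\tilde y_{i,k}=\sum_j l_{ij}^{(\gamma)}C_j^TR_j^{-1}y_{j,k}$. They differ in the estimate $U_{i,k}$ of $\tilde R_i$. All sums with weights $l^{(\gamma)}_{ij}$ are computed by $\gamma$ rounds of the fusion $Z_i\mapsto\sum_j l_{ij}Z_j$. Algorithm 1 (direct method): with row vectors $q_i\in\mathbb R^{1\times N}$, let $\tilde W_{i,0}=N q_i^Tq_i$, $\tilde W_{i,k}=\sum_j l_{ij}^{(\gamma)}\tilde W_{j,k-1}$, $\tilde u_i=\sum_j l_{ij}^{(\gamma)}Y_j^T(q_j\otimes I_n)$ and $U_{i,k}=\tilde u_i(\tilde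 W_{i,k}\otimes I_n)^\dagger\tilde u_i^T$. The entries of the $q_i$ are sampled independently from $\mathbf N(0,1)$. Algorithm 2 (stochastic method): with independent samples $\theta_{i,k}\sim\mathbf N(0,I_n)$ ($k\ge1$), let $\tilde\upsilon_{i,k}=\sum_j l_{ij}^{(\gamma)}Y_j^T\theta_{j,k}$, $U_{i,0}=0$ and $U_{i,k}=\frac{k-1}{k}U_{i,k-1}+\frac1k\tilde\upsilon_{i,k}\tilde\upsilon_{i,k}^T$. Theorem. Assume that $(A,\tilde C_i)$ is observable for every node $i$. Then for every $i$ the discrete algebraic Riccati equation $$P_i=A\bigl(P_i^{-1}+\tilde C_i^T\tilde R_i^\dagger\tilde C_i\bigr)^{-1}A^T+Q$$ has a unique positive definite solution $P_i$, and for all $\hat x_0$, $P_0>0$, $Y_i$ and all measurements as above: 1. In Algorithm 1, $P_{i,k+1|k}\to P_i$ as $k\to\infty$ whenever the $N\times N$ matrix with rows $q_1,\dots,q_N$ has full rank; with the entries of the $q_i$ sampled independently from $\mathbf N(0,1)$, $P_{i,k+1|k}\to P_i$ almost surely. 2. In Algorithm 2, $P_{i,k+1|k}\to P_i$ almost surely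 as $k\to\infty$. -/

import Mathlib

open scoped Matrix Kronecker Topology
open Filter MeasureTheory ProbabilityTheory

noncomputable section

/-! ### Moore-Penrose inverse of a real matrix -/

/-- The four Penrose equations: `X` is the Moore-Penrose inverse of the real matrix `M`. -/
structure IsMoorePenrose {a b : Type*} [Fintype a] [Fintype b]
    (M : Matrix a b ℝ) (X : Matrix b a ℝ) : Prop where
  mul_mul_self : M * X * M = M
  self_mul_mul : X * M * X = X
  symm_left : (M * X)ᵀ = M * X
  symm_right : (X * M)ᵀ = X * M

theorem IsMoorePenrose.unique {a b : Type*} [Fintype a] [Fintype b]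
    {M : Matrix a b ℝ} {X Z : Matrix b a ℝ}
    (hX : IsMoorePenrose M X) (hZ : IsMoorePenrose M Z) : X = Z := by
  have h1 : M * X = M * Z := by
    calc M * X = (M * Z * M) * X := by rw [hZ.mul_mul_self]
      _ = (M * Z) * (M * X) := by simp only [Matrix.mul_assoc]
      _ = (M * Z)ᵀ * (M * X)ᵀ := by rw [hX.symm_left, hZ.symm_left]
      _ = ((M * X * M) * Z)ᵀ := by rw [← Matrix.transpose_mul]; simp only [Matrix.mul_assoc]
      _ = M * Z := by rw [hX.mul_mul_self, hZ.symm_left]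
  have h2 : X * M = Z * M := by
    calc X * M = X * (M * Z * M) := by rw [hZ.mul_mul_self]
      _ = (X * M) * (Z * M) := by simp only [Matrix.mul_assoc]
      _ = (X * M)ᵀ * (Z * M)ᵀ := by rw [hX.symm_right, hZ.symm_right]
      _ = (Z * (M * X * M))ᵀ := by rw [← Matrix.transpose_mul]; simp only [Matrix.mul_assoc]
      _ = Z * M := by rw [hX.mul_mul_self, hZ.symm_right]
  calc X = X * M * X := hX.self_mul_mul.symm
    _ = Z * (M * X) := by rw [h2, Matrix.mul_assoc]
    _ = Z * M * Z := by rw [h1, Matrix.mul_assoc]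
    _ = Z := hZ.self_mul_mul

/-- For a symmetric matrix the Moore-Penrose inverse inverts the nonzero eigenvalues. -/
theorem exists_isMoorePenrose_of_symm {b : Type*} [Fintype b] [DecidableEq b]
    (H : Matrix b b ℝ) (hH : H.IsHermitian) :
    ∃ X : Matrix b b ℝ, IsMoorePenrose H X ∧ Xᵀ = X := by
  obtain ⟨V, d, hV, hd⟩ : ∃ (V : Matrix b b ℝ) (d : b → ℝ), Vᵀ * V = 1 ∧
      H = V * Matrix.diagonal d * Vᵀ := by
    refine ⟨(hH.eigenvectorUnitary : Matrix b b ℝ), hH.eigenvalues, ?_, ?_⟩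
    · have := Matrix.mem_unitaryGroup_iff'.1 hH.eigenvectorUnitary.2
      simpa [Matrix.star_eq_conjTranspose] using this
    · have := hH.spectral_theorem
      simpa [Unitary.conjStarAlgAut_apply, Matrix.star_eq_conjTranspose,
        Function.comp_def] using this
  have key : ∀ D E : Matrix b b ℝ, V * D * Vᵀ * (V * E * Vᵀ) = V * (D * E) * Vᵀ := by
    intro D E
    calc V * D * Vᵀ * (V * E * Vᵀ) = V * D * (Vᵀ * V) * E * Vᵀ := by
          simp only [Matrix.mul_assoc]
      _ = V * (D * E) * Vᵀ := by rw [hV]; simp only [Matrix.mul_assoc, Matrix.one_mul]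
  have hx : ∀ x : ℝ, x * x⁻¹ * x = x := fun x => mul_inv_mul_cancel x
  have hx' : ∀ x : ℝ, x⁻¹ * x * x⁻¹ = x⁻¹ := fun x => by
    have := mul_inv_mul_cancel x⁻¹
    rwa [inv_inv] at this
  refine ⟨V * Matrix.diagonal (fun i => (d i)⁻¹) * Vᵀ, ⟨?_, ?_, ?_, ?_⟩, ?_⟩
  · rw [hd, key, key]; simp only [Matrix.diagonal_mul_diagonal, hx]
  · rw [hd, key, key]; simp only [Matrix.diagonal_mul_diagonal, hx']
  · rw [hd, key]
    simp only [Matrix.diagonal_mul_diagonal, Matrix.transpose_mul, Matrix.transpose_transpose,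
      Matrix.diagonal_transpose, Matrix.mul_assoc]
  · rw [hd, key]
    simp only [Matrix.diagonal_mul_diagonal, Matrix.transpose_mul, Matrix.transpose_transpose,
      Matrix.diagonal_transpose, Matrix.mul_assoc]
  · simp only [Matrix.transpose_mul, Matrix.transpose_transpose,
      Matrix.diagonal_transpose, Matrix.mul_assoc]

theorem exists_isMoorePenrose {a b : Type*} [Fintype a] [Fintype b]
    (M : Matrix a b ℝ) : ∃ X : Matrix b a ℝ, IsMoorePenrose M X := by
  classical
  have hs : (Mᵀ * M).IsHermitian := by
    simpa using Matrix.isHermitian_conjTranspose_mul_self M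
  obtain ⟨K, hK, hKs⟩ := exists_isMoorePenrose_of_symm (Mᵀ * M) hs
  have h0 : Mᵀ * M * (1 - K * (Mᵀ * M)) = 0 := by
    rw [Matrix.mul_sub, Matrix.mul_one, ← Matrix.mul_assoc, hK.mul_mul_self, sub_self]
  have h1 : M * (1 - K * (Mᵀ * M)) = 0 := by
    have := (Matrix.conjTranspose_mul_self_mul_eq_zero M (1 - K * (Mᵀ * M))).1
      (by simpa using h0)
    simpa using this
  refine ⟨K * Mᵀ, ⟨?_, ?_, ?_, ?_⟩⟩
  · rw [Matrix.mul_sub, Matrix.mul_one, sub_eq_zero] at h1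
    calc M * (K * Mᵀ) * M = M * (K * (Mᵀ * M)) := by simp only [Matrix.mul_assoc]
      _ = M := h1.symm
  · calc K * Mᵀ * M * (K * Mᵀ) = (K * (Mᵀ * M) * K) * Mᵀ := by simp only [Matrix.mul_assoc]
      _ = K * Mᵀ := by rw [hK.self_mul_mul]
  · simp only [Matrix.transpose_mul, Matrix.transpose_transpose, hKs, Matrix.mul_assoc]
  · rw [Matrix.mul_assoc, hK.symm_right]

/-- The Moore-Penrose inverse `M†` of a real matrix. -/
def pinv {a b : Type*} [Fintype a] [Fintype b] (M : Matrix a b ℝ) : Matrix b a ℝ :=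
  Classical.choose (exists_isMoorePenrose M)

theorem pinv_spec {a b : Type*} [Fintype a] [Fintype b] (M : Matrix a b ℝ) :
    IsMoorePenrose M (pinv M) :=
  Classical.choose_spec (exists_isMoorePenrose M)

/-! ### Observability and consensus weights -/

/-- `(A, C)` is observable: for `x⁺ = A x`, `y = C x`, only the zero initial state produces the
zero output sequence, so that the initial state is determined by the outputs. -/
def Observable {n p : Type*} [Fintype n] [DecidableEq n]
    (A : Matrix n n ℝ) (C : Matrix p n ℝ) : Prop :=
  ∀ x : n → ℝ, (∀ k : ℕ, C *ᵥ (A ^ k *ᵥ x) = 0) → x = 0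

/-- `L` is a weight matrix for the undirected graph `G`: doubly stochastic, with positive
diagonal, and an off-diagonal entry is positive on the edges of `G` and zero elsewhere. -/
structure IsConsensusWeight {N : ℕ} (G : SimpleGraph (Fin N))
    (L : Matrix (Fin N) (Fin N) ℝ) : Prop where
  doublyStochastic : L ∈ doublyStochastic ℝ (Fin N)
  diag_pos : ∀ i, 0 < L i i
  pos_of_adj : ∀ i j, G.Adj i j → 0 < L i j
  zero_of_not_adj : ∀ i j, i ≠ j → ¬ G.Adj i j → L i j = 0

/-- `m` rounds of fusion `Z i ↦ ∑ j, l i j • Z j`, started from the local quantities `Z`. -/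
def fuse {N : ℕ} {V : Type*} [AddCommMonoid V] [Module ℝ V]
    (L : Matrix (Fin N) (Fin N) ℝ) : ℕ → (Fin N → V) → Fin N → V
  | 0, Z => Z
  | m + 1, Z => fun i => ∑ j, L i j • fuse L m Z j

/-! ### The filtering problem -/

/-- The data of the distributed filtering problem: `N` nodes, state dimension `n`, and outputs of
dimension `m i`. -/
structure FilterData (N n : ℕ) (m : Fin N → ℕ) where
  /-- state-transition matrix -/
  A : Matrix (Fin n) (Fin n) ℝ
  /-- process noise covariance -/
  Q : Matrix (Fin n) (Fin n) ℝ
  /-- observation matrices -/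
  C : (i : Fin N) → Matrix (Fin (m i)) (Fin n) ℝ
  /-- measurement noise covariances -/
  R : (i : Fin N) → Matrix (Fin (m i)) (Fin (m i)) ℝ
  /-- consensus weights -/
  L : Matrix (Fin N) (Fin N) ℝ
  /-- number of fusion steps between two sampling instants -/
  γ : ℕ

namespace FilterData

variable {N n : ℕ} {m : Fin N → ℕ} (D : FilterData N n m)

/-- `Cᵢᵀ Rᵢ⁻¹ Cᵢ` -/
def info (i : Fin N) : Matrix (Fin n) (Fin n) ℝ := (D.C i)ᵀ * (D.R i)⁻¹ * D.C i

/-- The fused observation matrix `C̃ᵢ`, obtained after `γ` fusion rounds. -/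
def Ctilde : Fin N → Matrix (Fin n) (Fin n) ℝ := fuse D.L D.γ D.info

/-- The exact covariance `R̃ᵢ = ∑ⱼ (l_ij^(γ))² Cⱼᵀ Rⱼ⁻¹ Cⱼ` of the fused measurement noise. -/
def Rtilde (i : Fin N) : Matrix (Fin n) (Fin n) ℝ :=
  ∑ j, ((D.L ^ D.γ) i j) ^ 2 • D.info j

/-- `P = A (P⁻¹ + C̃ᵢᵀ R̃ᵢ† C̃ᵢ)⁻¹ Aᵀ + Q` -/
def DARE (i : Fin N) (P : Matrix (Fin n) (Fin n) ℝ) : Prop :=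
  P = D.A * (P⁻¹ + (D.Ctilde i)ᵀ * pinv (D.Rtilde i) * D.Ctilde i)⁻¹ * D.Aᵀ + D.Q

/-! #### Steps shared by the two algorithms -/

/-- The fused measurements `ỹᵢ`, from the measurements `y` of one sampling instant. -/
def ytilde (y : (i : Fin N) → Fin (m i) → ℝ) : Fin N → Fin n → ℝ :=
  fuse D.L D.γ fun i => ((D.C i)ᵀ * (D.R i)⁻¹) *ᵥ y i

/-- Covariance prediction. -/
def predictCov (P : Matrix (Fin n) (Fin n) ℝ) : Matrix (Fin n) (Fin n) ℝ :=
  D.A * P * D.Aᵀ + D.Q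

/-- Covariance correction at node `i`, from the prior covariance `P` and the current estimate `U`
of the fused noise covariance. -/
def correctCov (i : Fin N) (U P : Matrix (Fin n) (Fin n) ℝ) : Matrix (Fin n) (Fin n) ℝ :=
  (P⁻¹ + (D.Ctilde i)ᵀ * pinv U * D.Ctilde i)⁻¹

/-- State correction at node `i`, from the prior covariance `P`, the prior estimate `x` and the
fused measurement `z`. -/
def correctMean (i : Fin N) (U P : Matrix (Fin n) (Fin n) ℝ) (x z : Fin n → ℝ) : Fin n → ℝ :=
  D.correctCov i U P *ᵥ (P⁻¹ *ᵥ x + ((D.Ctilde i)ᵀ * pinv U) *ᵥ z)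

/-! #### Modified CM with the direct method -/

/-- The quantities kept by the nodes at the end of step `k`: the posterior estimates `x̂_{i,k|k}`,
the posterior covariances `P_{i,k|k}`, and `W̃_{i,k}^(γ)`. -/
structure DirectState (N n : ℕ) where
  xhat : Fin N → Fin n → ℝ
  P : Fin N → Matrix (Fin n) (Fin n) ℝ
  W : Fin N → Matrix (Fin N) (Fin N) ℝ

/-- `q ⊗ Iₙ` for a row vector `q`. -/
def rowKron (q : Fin N → ℝ) : Matrix (Fin n) (Fin N × Fin n) ℝ :=
  (Matrix.replicateRow Unit q ⊗ₖ (1 : Matrix (Fin n) (Fin n) ℝ)).submatrix (fun a => ((), a)) id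

/-- `ũᵢ^(γ)`, the fusion of `Yⱼᵀ (qⱼ ⊗ Iₙ)`. -/
def utilde (Y : Fin N → Matrix (Fin n) (Fin n) ℝ) (q : Matrix (Fin N) (Fin N) ℝ) :
    Fin N → Matrix (Fin n) (Fin N × Fin n) ℝ :=
  fuse D.L D.γ fun j => (Y j)ᵀ * rowKron (q j)

/-- `Ũᵢ = ũᵢ (W̃ᵢ ⊗ Iₙ)† ũᵢᵀ` -/
def Utilde (Y : Fin N → Matrix (Fin n) (Fin n) ℝ) (q : Matrix (Fin N) (Fin N) ℝ)
    (W : Fin N → Matrix (Fin N) (Fin N) ℝ) (i : Fin N) : Matrix (Fin n) (Fin n) ℝ :=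
  D.utilde Y q i * pinv (W i ⊗ₖ (1 : Matrix (Fin n) (Fin n) ℝ)) * (D.utilde Y q i)ᵀ

/-- One step of the direct method; `y` holds the measurements of that step. -/
def directStep (Y : Fin N → Matrix (Fin n) (Fin n) ℝ) (q : Matrix (Fin N) (Fin N) ℝ)
    (y : (i : Fin N) → Fin (m i) → ℝ) (s : DirectState N n) : DirectState N n :=
  let W := fuse D.L D.γ s.W
  { xhat := fun i => D.correctMean i (D.Utilde Y q W i) (D.predictCov (s.P i))
      (D.A *ᵥ s.xhat i) (D.ytilde y i)
    P := fun i => D.correctCov i (D.Utilde Y q W i) (D.predictCov (s.P i))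
    W := W }

/-- The direct method, started at `(x̂₀, P₀)`, with factors `Yᵢᵀ Yᵢ = Cᵢᵀ Rᵢ⁻¹ Cᵢ`, row vectors
`qᵢ = q i` and measurements `y k` at the times `k ≥ 1`. -/
def direct (x₀ : Fin n → ℝ) (P₀ : Matrix (Fin n) (Fin n) ℝ)
    (Y : Fin N → Matrix (Fin n) (Fin n) ℝ) (q : Matrix (Fin N) (Fin N) ℝ)
    (y : ℕ → (i : Fin N) → Fin (m i) → ℝ) : ℕ → DirectState N n
  | 0 => { xhat := fun _ => x₀
           P := fun _ => P₀
           W := fun i => (N : ℝ) • Matrix.vecMulVec (q i) (q i) }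
  | k + 1 => D.directStep Y q (y (k + 1)) (direct x₀ P₀ Y q y k)

/-- The prior covariance `P_{i,k+1|k}` computed by the direct method. -/
def directPrior (x₀ : Fin n → ℝ) (P₀ : Matrix (Fin n) (Fin n) ℝ)
    (Y : Fin N → Matrix (Fin n) (Fin n) ℝ) (q : Matrix (Fin N) (Fin N) ℝ)
    (y : ℕ → (i : Fin N) → Fin (m i) → ℝ) (i : Fin N) (k : ℕ) : Matrix (Fin n) (Fin n) ℝ :=
  D.predictCov ((D.direct x₀ P₀ Y q y k).P i)

/-! #### Modified CM with the stochastic method -/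

/-- The quantities kept by the nodes at the end of step `k`: `x̂_{i,k|k}`, `P_{i,k|k}` and the
estimate `Υ̃_{i,k}` of the fused noise covariance. -/
structure StochState (N n : ℕ) where
  xhat : Fin N → Fin n → ℝ
  P : Fin N → Matrix (Fin n) (Fin n) ℝ
  Ups : Fin N → Matrix (Fin n) (Fin n) ℝ

/-- `υ̃ᵢ^(γ)`, the fusion of `Yⱼᵀ θⱼ`. -/
def upsilon (Y : Fin N → Matrix (Fin n) (Fin n) ℝ) (θ : Fin N → Fin n → ℝ) :
    Fin N → Fin n → ℝ :=
  fuse D.L D.γ fun j => (Y j)ᵀ *ᵥ θ j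

/-- Step number `k` of the stochastic method, with samples `θ` and measurements `y`. -/
def stochStep (Y : Fin N → Matrix (Fin n) (Fin n) ℝ) (k : ℕ) (θ : Fin N → Fin n → ℝ)
    (y : (i : Fin N) → Fin (m i) → ℝ) (s : StochState N n) : StochState N n :=
  let Ups : Fin N → Matrix (Fin n) (Fin n) ℝ := fun i =>
    (((k : ℝ) - 1) / k) • s.Ups i +
      (1 / (k : ℝ)) • Matrix.vecMulVec (D.upsilon Y θ i) (D.upsilon Y θ i)
  { xhat := fun i => D.correctMean i (Ups i) (D.predictCov (s.P i))
      (D.A *ᵥ s.xhat i) (D.ytilde y i)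
    P := fun i => D.correctCov i (Ups i) (D.predictCov (s.P i))
    Ups := Ups }

/-- The stochastic method, started at `(x̂₀, P₀)`, with factors `Yᵢᵀ Yᵢ = Cᵢᵀ Rᵢ⁻¹ Cᵢ`, samples
`θ k i` and measurements `y k i` at the times `k ≥ 1`. -/
def stoch (x₀ : Fin n → ℝ) (P₀ : Matrix (Fin n) (Fin n) ℝ)
    (Y : Fin N → Matrix (Fin n) (Fin n) ℝ) (θ : ℕ → Fin N → Fin n → ℝ)
    (y : ℕ → (i : Fin N) → Fin (m i) → ℝ) : ℕ → StochState N n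
  | 0 => { xhat := fun _ => x₀
           P := fun _ => P₀
           Ups := fun _ => 0 }
  | k + 1 => D.stochStep Y (k + 1) (θ (k + 1)) (y (k + 1)) (stoch x₀ P₀ Y θ y k)

/-- The prior covariance `P_{i,k+1|k}` computed by the stochastic method. -/
def stochPrior (x₀ : Fin n → ℝ) (P₀ : Matrix (Fin n) (Fin n) ℝ)
    (Y : Fin N → Matrix (Fin n) (Fin n) ℝ) (θ : ℕ → Fin N → Fin n → ℝ)
    (y : ℕ → (i : Fin N) → Fin (m i) → ℝ) (i : Fin N) (k : ℕ) : Matrix (Fin n) (Fin n) ℝ :=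
  D.predictCov ((D.stoch x₀ P₀ Y θ y k).P i)

end FilterData

end

/-! ### Quadratic forms of real matrices -/

section QuadraticForm

variable {n p : Type*} [Fintype n] [Fintype p]

/-- The quadratic form `vᵀ M v` of a square matrix. -/
def qform (M : Matrix n n ℝ) (v : n → ℝ) : ℝ := v ⬝ᵥ M *ᵥ v

theorem qform_add (M M' : Matrix n n ℝ) (v : n → ℝ) :
    qform (M + M') v = qform M v + qform M' v := by
  simp [qform, Matrix.add_mulVec, dotProduct_add]

theorem qform_sub (M M' : Matrix n n ℝ) (v : n → ℝ) :
    qform (M - M') v = qform M v - qform M' v := by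
  simp [qform, Matrix.sub_mulVec, dotProduct_sub]

theorem qform_smul (c : ℝ) (M : Matrix n n ℝ) (v : n → ℝ) :
    qform (c • M) v = c * qform M v := by
  simp [qform, Matrix.smul_mulVec]

theorem qform_smul_vec (c : ℝ) (M : Matrix n n ℝ) (v : n → ℝ) :
    qform M (c • v) = c ^ 2 * qform M v := by
  simp [qform, Matrix.mulVec_smul]; ring

theorem qform_conj (M : Matrix n n ℝ) (A : Matrix p n ℝ) (v : p → ℝ) :
    qform (A * M * Aᵀ) v = qform M (Aᵀ *ᵥ v) := by
  simp only [qform, ← Matrix.mulVec_mulVec, Matrix.dotProduct_mulVec v,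
    Matrix.mulVec_transpose]

theorem qform_eq_sum (M : Matrix n n ℝ) (v : n → ℝ) :
    qform M v = ∑ a, ∑ b, v a * M a b * v b := by
  simp [qform, dotProduct, Matrix.mulVec, Finset.mul_sum, mul_assoc]

theorem Matrix.IsHermitian.dotProduct_mulVec_comm {M : Matrix n n ℝ} (hM : M.IsHermitian)
    (v w : n → ℝ) : v ⬝ᵥ M *ᵥ w = w ⬝ᵥ M *ᵥ v := by
  rw [Matrix.dotProduct_mulVec, ← Matrix.mulVec_transpose, dotProduct_comm]
  have : Mᵀ = M := by simpa using hM.eq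
  rw [this]

theorem qform_add_vec {M : Matrix n n ℝ} (hM : M.IsHermitian) (v w : n → ℝ) :
    qform M (v + w) = qform M v + 2 * (v ⬝ᵥ M *ᵥ w) + qform M w := by
  simp only [qform, Matrix.mulVec_add, dotProduct_add, add_dotProduct]
  rw [hM.dotProduct_mulVec_comm w v]; ring

theorem qform_sub_vec {M : Matrix n n ℝ} (hM : M.IsHermitian) (v w : n → ℝ) :
    qform M (v - w) = qform M v - 2 * (v ⬝ᵥ M *ᵥ w) + qform M w := by
  simp only [qform, Matrix.mulVec_sub, dotProduct_sub, sub_dotProduct]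
  rw [hM.dotProduct_mulVec_comm w v]; ring

theorem Matrix.PosSemidef.qform_nonneg {M : Matrix n n ℝ} (hM : M.PosSemidef) (v : n → ℝ) :
    0 ≤ qform M v := by
  simpa [qform] using hM.dotProduct_mulVec_nonneg v

theorem Matrix.PosDef.qform_pos {M : Matrix n n ℝ} (hM : M.PosDef) {v : n → ℝ} (hv : v ≠ 0) :
    0 < qform M v := by
  simpa [qform] using hM.dotProduct_mulVec_pos hv

theorem Matrix.PosDef.qform_nonneg {M : Matrix n n ℝ} (hM : M.PosDef) (v : n → ℝ) :
    0 ≤ qform M v := hM.posSemidef.qform_nonneg v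

theorem posDef_of_le_qform {M M' : Matrix n n ℝ} (hM : M.PosDef) (hM' : M'.IsHermitian)
    (h : ∀ v, qform M v ≤ qform M' v) : M'.PosDef :=
  .of_dotProduct_mulVec_pos hM' fun v hv => by
    simpa [qform] using (hM.qform_pos hv).trans_le (h v)

theorem dotProduct_self_nonneg' (v : n → ℝ) : 0 ≤ v ⬝ᵥ v :=
  Finset.sum_nonneg fun i _ => mul_self_nonneg (v i)

theorem sq_le_dotProduct_self (v : n → ℝ) (a : n) : v a ^ 2 ≤ v ⬝ᵥ v := by
  rw [sq]
  exact Finset.single_le_sum (f := fun i => v i * v i) (fun i _ => mul_self_nonneg (v i))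
    (Finset.mem_univ a)

theorem abs_qform_le (M : Matrix n n ℝ) (v : n → ℝ) :
    |qform M v| ≤ (∑ a, ∑ b, |M a b|) * (v ⬝ᵥ v) := by
  rw [qform_eq_sum, Finset.sum_mul]
  refine (Finset.abs_sum_le_sum_abs _ _).trans (Finset.sum_le_sum fun a _ => ?_)
  rw [Finset.sum_mul]
  refine (Finset.abs_sum_le_sum_abs _ _).trans (Finset.sum_le_sum fun b _ => ?_)
  have h : |v a * v b| ≤ v ⬝ᵥ v := by
    rw [abs_le]
    have := sq_le_dotProduct_self v a
    have := sq_le_dotProduct_self v b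
    constructor <;> nlinarith [sq_nonneg (v a - v b), sq_nonneg (v a + v b)]
  calc |v a * M a b * v b| = |M a b| * |v a * v b| := by rw [← abs_mul]; ring_nf
    _ ≤ _ := mul_le_mul_of_nonneg_left h (abs_nonneg _)

/-- Entries of a symmetric matrix by polarization of its quadratic form. -/
theorem entry_eq_qform [DecidableEq n] {M : Matrix n n ℝ} (hM : M.IsHermitian) (a b : n) :
    M a b = (qform M (Pi.single a 1 + Pi.single b 1) - qform M (Pi.single a 1)
      - qform M (Pi.single b 1)) / 2 := by
  rw [qform_add_vec hM]
  have : (Pi.single a 1 : n → ℝ) ⬝ᵥ M *ᵥ Pi.single b 1 = M a b := by simp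
  rw [this]; ring

theorem tendsto_of_qform [DecidableEq n] {ι : Type*} {l : Filter ι} {M : ι → Matrix n n ℝ}
    {M' : Matrix n n ℝ} (hM : ∀ k, (M k).IsHermitian) (hM' : M'.IsHermitian)
    (h : ∀ v, Tendsto (fun k => qform (M k) v) l (𝓝 (qform M' v))) : Tendsto M l (𝓝 M') := by
  refine tendsto_pi_nhds.2 fun a => tendsto_pi_nhds.2 fun b => ?_
  rw [entry_eq_qform hM' a b]
  simp_rw [fun k => entry_eq_qform (hM k) a b]
  exact (((h _).sub (h _)).sub (h _)).div_const 2

theorem continuous_qform (v : n → ℝ) : Continuous fun M : Matrix n n ℝ => qform M v := by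
  unfold qform; fun_prop

section Inverse

variable [DecidableEq n]

theorem Matrix.PosDef.isUnit_det {M : Matrix n n ℝ} (hM : M.PosDef) : IsUnit M.det :=
  (Matrix.isUnit_iff_isUnit_det M).1 hM.isUnit

theorem Matrix.PosDef.mul_inv {M : Matrix n n ℝ} (hM : M.PosDef) : M * M⁻¹ = 1 :=
  Matrix.mul_nonsing_inv _ hM.isUnit_det

theorem Matrix.PosDef.qform_inv_eq {M : Matrix n n ℝ} (hM : M.PosDef) (v : n → ℝ) :
    qform M⁻¹ v = 2 * (v ⬝ᵥ M⁻¹ *ᵥ v) - qform M (M⁻¹ *ᵥ v) := by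
  have : qform M (M⁻¹ *ᵥ v) = qform M⁻¹ v := by
    simp only [qform, Matrix.mulVec_mulVec, hM.mul_inv, Matrix.one_mulVec, dotProduct_comm]
  rw [this, qform]; ring

/-- Variational description of the inverse of a positive definite matrix. -/
theorem Matrix.PosDef.two_mul_sub_le_qform_inv {M : Matrix n n ℝ} (hM : M.PosDef)
    (v z : n → ℝ) : 2 * (v ⬝ᵥ z) - qform M z ≤ qform M⁻¹ v := by
  have h := hM.qform_nonneg (z - M⁻¹ *ᵥ v)
  rw [qform_sub_vec hM.1, Matrix.mulVec_mulVec, hM.mul_inv, Matrix.one_mulVec] at h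
  have h2 := hM.qform_inv_eq v
  have h3 : v ⬝ᵥ M⁻¹ *ᵥ v = qform M⁻¹ v := rfl
  rw [dotProduct_comm z v] at h
  linarith

theorem qform_inv_anti {M M' : Matrix n n ℝ} (hM : M.PosDef) (hM' : M'.PosDef)
    (h : ∀ v, qform M v ≤ qform M' v) (v : n → ℝ) : qform M'⁻¹ v ≤ qform M⁻¹ v := by
  rw [hM'.qform_inv_eq]
  have := hM.two_mul_sub_le_qform_inv v (M'⁻¹ *ᵥ v)
  linarith [h (M'⁻¹ *ᵥ v)]

theorem qform_inv_anti_smul {M M' : Matrix n n ℝ} (hM : M.PosDef) (hM' : M'.PosDef) {t : ℝ}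
    (ht : 0 < t) (h : ∀ v, qform M v ≤ t * qform M' v) (v : n → ℝ) :
    qform M'⁻¹ v ≤ t * qform M⁻¹ v := by
  have h1 := qform_inv_anti (hM.smul (inv_pos.2 ht)) hM' (fun v => by
    rw [qform_smul, inv_mul_le_iff₀ ht]; exact h v) v
  have h2 : (t⁻¹ • M)⁻¹ = t • M⁻¹ := by
    refine Matrix.inv_eq_left_inv ?_
    rw [Matrix.smul_mul, Matrix.mul_smul, smul_smul, mul_inv_cancel₀ ht.ne', one_smul,
      Matrix.nonsing_inv_mul _ hM.isUnit_det]
  rwa [h2, qform_smul] at h1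

/-- A positive definite form dominates a positive multiple of the Euclidean form. -/
theorem Matrix.PosDef.exists_dotProduct_self_le {M : Matrix n n ℝ} (hM : M.PosDef) :
    ∃ c : ℝ, 0 < c ∧ ∀ v, v ⬝ᵥ v ≤ c * qform M v := by
  set T := ∑ a, ∑ b, |M⁻¹ a b| with hT
  have hT0 : 0 ≤ T := Finset.sum_nonneg fun a _ => Finset.sum_nonneg fun b _ => abs_nonneg _
  refine ⟨T + 1, by linarith, fun v => ?_⟩
  have h := hM.inv.two_mul_sub_le_qform_inv v ((T + 1)⁻¹ • v)
  rw [Matrix.nonsing_inv_nonsing_inv _ hM.isUnit_det, qform_smul_vec, dotProduct_smul,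
    smul_eq_mul] at h
  have h2 := (le_abs_self _).trans (abs_qform_le M⁻¹ v)
  have h0 := dotProduct_self_nonneg' v
  have h1 : qform M⁻¹ v ≤ (T + 1) * (v ⬝ᵥ v) := h2.trans (by rw [← hT]; nlinarith)
  have h3 : 0 < (T + 1)⁻¹ := by positivity
  have h4 : ((T + 1)⁻¹) ^ 2 * qform M⁻¹ v ≤ (T + 1)⁻¹ * (v ⬝ᵥ v) := by
    calc ((T + 1)⁻¹) ^ 2 * qform M⁻¹ v ≤ ((T + 1)⁻¹) ^ 2 * ((T + 1) * (v ⬝ᵥ v)) := by gcongr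
      _ = (T + 1)⁻¹ * (v ⬝ᵥ v) := by field_simp
  have h5 : (T + 1)⁻¹ * (v ⬝ᵥ v) ≤ qform M v := by linarith
  rwa [inv_mul_le_iff₀ (by linarith)] at h5

/-- Any form is dominated by a multiple of a positive definite one. -/
theorem Matrix.PosDef.exists_qform_le {M : Matrix n n ℝ} (hM : M.PosDef) (M' : Matrix n n ℝ) :
    ∃ c : ℝ, 0 < c ∧ ∀ v, qform M' v ≤ c * qform M v := by
  obtain ⟨c, hc, h⟩ := hM.exists_dotProduct_self_le
  set T := ∑ a, ∑ b, |M' a b| with hT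
  have hT0 : 0 ≤ T := Finset.sum_nonneg fun a _ => Finset.sum_nonneg fun b _ => abs_nonneg _
  refine ⟨(T + 1) * c, by positivity, fun v => ?_⟩
  have h1 := (le_abs_self _).trans (abs_qform_le M' v)
  have h0 := dotProduct_self_nonneg' v
  rw [← hT] at h1
  calc qform M' v ≤ (T + 1) * (v ⬝ᵥ v) := by nlinarith
    _ ≤ (T + 1) * (c * qform M v) := by gcongr; exact h v
    _ = _ := by ring

/-- Convergence of matrices gives convergence of the forms, uniformly relative to a positive
definite form. -/
theorem Matrix.PosDef.eventually_abs_qform_sub_le {B : Matrix n n ℝ} (hB : B.PosDef)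
    {ι : Type*} {l : Filter ι} {M : ι → Matrix n n ℝ} {M' : Matrix n n ℝ}
    (h : Tendsto M l (𝓝 M')) {δ : ℝ} (hδ : 0 < δ) :
    ∀ᶠ k in l, ∀ v, |qform (M k) v - qform M' v| ≤ δ * qform B v := by
  obtain ⟨c, hc, hcB⟩ := hB.exists_dotProduct_self_le
  have h1 : Tendsto (fun k => ∑ a, ∑ b, |(M k - M') a b|) l (𝓝 0) := by
    have : Continuous fun X : Matrix n n ℝ => ∑ a, ∑ b, |(X - M') a b| := by
      simp only [Matrix.sub_apply]; fun_prop
    simpa [Function.comp_def] using (this.tendsto M').comp h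
  filter_upwards [h1.eventually (gt_mem_nhds (show 0 < δ / c by positivity))] with k hk v
  rw [← qform_sub]
  calc |qform (M k - M') v| ≤ (∑ a, ∑ b, |(M k - M') a b|) * (v ⬝ᵥ v) := abs_qform_le _ _
    _ ≤ δ / c * (c * qform B v) :=
      mul_le_mul hk.le (hcB v) (dotProduct_self_nonneg' v) (by positivity)
    _ = δ * qform B v := by field_simp

end Inverse

/-- A positive semidefinite form is bounded in terms of its diagonal entries. -/
theorem Matrix.PosSemidef.qform_le_sum_diag {M : Matrix n n ℝ} (hM : M.PosSemidef) (v : n → ℝ) :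
    qform M v ≤ (∑ a, ∑ b, (M a a + M b b) / 2) * (v ⬝ᵥ v) := by
  classical
  refine ((le_abs_self _).trans (abs_qform_le M v)).trans
    (mul_le_mul_of_nonneg_right (Finset.sum_le_sum fun a _ => Finset.sum_le_sum fun b _ => ?_)
      (dotProduct_self_nonneg' v))
  have e : ∀ c : n, qform M (Pi.single c 1) = M c c := fun c => by simp [qform]
  have e2 : (Pi.single a 1 : n → ℝ) ⬝ᵥ M *ᵥ Pi.single b 1 = M a b := by simp
  have h1 := hM.qform_nonneg (Pi.single a 1 + Pi.single b 1)
  have h2 := hM.qform_nonneg (Pi.single a 1 - Pi.single b 1)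
  rw [qform_add_vec hM.1, e, e, e2] at h1
  rw [qform_sub_vec hM.1, e, e, e2] at h2
  rw [abs_le]; constructor <;> linarith

end QuadraticForm

/-! ### The Riccati recursion with time-varying information matrices -/

section Riccati

theorem eventually_atTop_of_succ {p : ℕ → Prop} (h : ∀ᶠ k in atTop, p (k + 1)) :
    ∀ᶠ k in atTop, p k := by
  obtain ⟨a, ha⟩ := eventually_atTop.1 h
  refine eventually_atTop.2 ⟨a + 1, fun b hb => ?_⟩
  obtain ⟨c, rfl⟩ : ∃ c, b = c + 1 := ⟨b - 1, by omega⟩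
  exact ha c (by omega)

/-- If, for every error level `e`, one step eventually shrinks the error by a fixed factor,
then the error is eventually arbitrarily small. -/
theorem eventually_of_contraction {p : ℕ → ℝ → Prop} {ρ : ℝ} (hρ0 : 0 < ρ) (hρ1 : ρ < 1)
    (mono : ∀ k e e', e ≤ e' → p k e → p k e')
    (step : ∀ e, 0 < e → ∀ᶠ k in atTop, p k e → p (k + 1) (ρ * e))
    (init : ∃ e, 0 < e ∧ ∀ᶠ k in atTop, p k e) {ε : ℝ} (hε : 0 < ε) :
    ∀ᶠ k in atTop, p k ε := by
  obtain ⟨E, hE, h0⟩ := init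
  have key : ∀ j : ℕ, ∀ᶠ k in atTop, p k (ρ ^ j * E) := by
    intro j
    induction j with
    | zero => simpa using h0
    | succ j ih =>
      refine eventually_atTop_of_succ ?_
      filter_upwards [ih, step (ρ ^ j * E) (by positivity)] with k h1 h2
      rw [pow_succ', mul_assoc]
      exact h2 h1
  have hlim : Tendsto (fun j : ℕ => ρ ^ j * E) atTop (𝓝 0) := by
    simpa using (tendsto_pow_atTop_nhds_zero_of_lt_one hρ0.le hρ1).mul_const E
  obtain ⟨j, hj⟩ := (hlim.eventually (gt_mem_nhds hε)).exists
  filter_upwards [key j] with k hk using mono k _ _ hj.le hk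

variable {n p : Type*} [Fintype n] [DecidableEq n] [Fintype p]

/-- One step of the Riccati recursion for prior covariances, with information matrix `S`. -/
noncomputable def riccati (A Q S P : Matrix n n ℝ) : Matrix n n ℝ := A * (P⁻¹ + S)⁻¹ * Aᵀ + Q

variable {A Q S P : Matrix n n ℝ}

theorem Matrix.PosDef.inv_add (hP : P.PosDef) (hS : S.PosSemidef) : (P⁻¹ + S).PosDef :=
  hP.inv.add_posSemidef hS

theorem qform_riccati (A Q S P : Matrix n n ℝ) (v : n → ℝ) :
    qform (riccati A Q S P) v = qform (P⁻¹ + S)⁻¹ (Aᵀ *ᵥ v) + qform Q v := by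
  rw [riccati, qform_add, qform_conj]

theorem riccati_posDef (A : Matrix n n ℝ) (hQ : Q.PosDef) (hS : S.PosSemidef) (hP : P.PosDef) :
    (riccati A Q S P).PosDef := by
  have h := (hP.inv_add hS).inv.posSemidef.mul_mul_conjTranspose_same A
  exact hQ.posSemidef_add (by simpa using h)

theorem qform_le_qform_riccati (A : Matrix n n ℝ) (hS : S.PosSemidef) (hP : P.PosDef)
    (v : n → ℝ) : qform Q v ≤ qform (riccati A Q S P) v := by
  rw [qform_riccati]
  linarith [(hP.inv_add hS).inv.qform_nonneg (Aᵀ *ᵥ v)]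

theorem qform_riccati_mono (A Q : Matrix n n ℝ) {P' : Matrix n n ℝ} (hS : S.PosSemidef)
    (hP : P.PosDef) (hP' : P'.PosDef) (h : ∀ v, qform P v ≤ qform P' v) (v : n → ℝ) :
    qform (riccati A Q S P) v ≤ qform (riccati A Q S P') v := by
  rw [qform_riccati, qform_riccati]
  refine add_le_add_left (qform_inv_anti (hP'.inv_add hS) (hP.inv_add hS) (fun w => ?_) _) _
  rw [qform_add, qform_add]
  exact add_le_add_left (qform_inv_anti hP hP' h w) _

/-- The covariance of any linear estimate bounds the optimal covariance; dually, the cost of any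
control `u` bounds the optimal cost. -/
theorem qform_riccati_le (A Q : Matrix n n ℝ) (hS : S.PosSemidef) (hP : P.PosDef)
    {C : Matrix p n ℝ} {r : ℝ}
    (hC : ∀ u z, 2 * (u ⬝ᵥ C *ᵥ z) ≤ qform S z + r * (u ⬝ᵥ u)) (x : n → ℝ) (u : p → ℝ) :
    qform (riccati A Q S P) x ≤
      qform P (Aᵀ *ᵥ x - Cᵀ *ᵥ u) + r * (u ⬝ᵥ u) + qform Q x := by
  rw [qform_riccati, (hP.inv_add hS).qform_inv_eq]
  set z := (P⁻¹ + S)⁻¹ *ᵥ (Aᵀ *ᵥ x)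
  rw [qform_add]
  have h1 := hP.inv.two_mul_sub_le_qform_inv (Aᵀ *ᵥ x - Cᵀ *ᵥ u) z
  rw [Matrix.nonsing_inv_nonsing_inv _ hP.isUnit_det, sub_dotProduct] at h1
  have h2 := hC u z
  have h3 : Cᵀ *ᵥ u ⬝ᵥ z = u ⬝ᵥ C *ᵥ z := by
    rw [Matrix.mulVec_transpose, ← Matrix.dotProduct_mulVec]
  linarith

section Contraction

variable {S' X : Matrix n n ℝ} {c δ t : ℝ}

theorem riccati_contraction_upper (hS : S.PosSemidef) (hP : P.PosDef)
    (hfix : riccati A Q S P = P)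
    (hcQ : ∀ v, c * qform P v ≤ qform Q v) (hS' : S'.PosSemidef) (hX : X.PosDef)
    (hδ : 0 ≤ δ) (hSS' : ∀ v, |qform S' v - qform S v| ≤ δ * qform P⁻¹ v)
    (ht : 1 ≤ t) (hδt : δ * t < 1) (h : ∀ v, qform X v ≤ t * qform P v) (v : n → ℝ) :
    qform (riccati A Q S' X) v ≤ (1 + (1 - c) * (t / (1 - δ * t) - 1)) * qform P v := by
  have h1 := qform_inv_anti_smul hX hP (by linarith) h
  set τ := t / (1 - δ * t) with hτ
  have hd : 0 < 1 - δ * t := by linarith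
  have hτ1 : 1 ≤ τ := by rw [hτ, one_le_div hd]; nlinarith
  have h2 : ∀ w, qform (P⁻¹ + S) w ≤ τ * qform (X⁻¹ + S') w := fun w => by
    rw [hτ, div_mul_eq_mul_div, le_div_iff₀ hd, qform_add, qform_add]
    have h3 := (abs_le.1 (hSS' w)).1
    have h4 := h1 w
    have h5 := hS.qform_nonneg w
    have h6 : t * (qform S w - δ * qform P⁻¹ w) ≤ t * qform S' w := by gcongr; linarith
    have h7 : 0 ≤ (t - 1 + δ * t) * qform S w :=
      mul_nonneg (by nlinarith) h5
    nlinarith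
  have h3 := qform_inv_anti_smul (hP.inv_add hS) (hX.inv_add hS') (by linarith) h2 (Aᵀ *ᵥ v)
  have h4 := qform_riccati A Q S P v
  rw [hfix] at h4
  rw [qform_riccati]
  have h5 := mul_le_mul_of_nonneg_left (hcQ v) (sub_nonneg.2 hτ1)
  nlinarith

theorem riccati_contraction_lower (hQ : Q.PosDef) (hS : S.PosSemidef) (hP : P.PosDef)
    (hfix : riccati A Q S P = P) (hc0 : 0 ≤ c) (hc1 : c ≤ 1)
    (hcQ : ∀ v, c * qform P v ≤ qform Q v) (hS' : S'.PosSemidef) (hX : X.PosDef)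
    (hδ : 0 ≤ δ) (hSS' : ∀ v, |qform S' v - qform S v| ≤ δ * qform P⁻¹ v)
    (ht : 1 ≤ t) (h : ∀ v, qform P v ≤ t * qform X v) (v : n → ℝ) :
    qform P v ≤ (1 + (1 - c) * (t + δ - 1)) * qform (riccati A Q S' X) v := by
  have h1 := qform_inv_anti_smul hP hX (by linarith) h
  have h2 : ∀ w, qform (X⁻¹ + S') w ≤ (t + δ) * qform (P⁻¹ + S) w := fun w => by
    rw [qform_add, qform_add]
    have h3 := (abs_le.1 (hSS' w)).2
    have h4 := h1 w
    have h5 : 0 ≤ (t + δ - 1) * qform S w := mul_nonneg (by linarith) (hS.qform_nonneg w)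
    nlinarith
  have h3 := qform_inv_anti_smul (hX.inv_add hS') (hP.inv_add hS) (by linarith) h2 (Aᵀ *ᵥ v)
  have h4 := qform_riccati A Q S P v
  rw [hfix] at h4
  have h6 := qform_riccati A Q S' X v
  set Z := qform (riccati A Q S' X) v with hZ
  have hZ0 : 0 ≤ Z := (riccati_posDef A hQ hS' hX).qform_nonneg v
  set σ := t + δ - 1 with hσ
  have hσ0 : 0 ≤ σ := by linarith
  have h5 := mul_le_mul_of_nonneg_left (hcQ v) hσ0
  have h7 : (1 + σ * c) * qform P v ≤ (1 + σ) * Z := by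
    have : t + δ = 1 + σ := by rw [hσ]; ring
    rw [this] at h3
    nlinarith
  have h8 : 0 < 1 + σ * c := by positivity
  have h9 : (1 + σ) * Z ≤ (1 + σ * c) * ((1 + (1 - c) * σ) * Z) := by
    have : 0 ≤ (c * (1 - c) * σ ^ 2) * Z := by
      have : 0 ≤ 1 - c := by linarith
      positivity
    nlinarith
  exact le_of_mul_le_mul_left (h7.trans h9) h8

end Contraction

/-- A bounded trajectory of the perturbed Riccati recursion converges to a positive definite
fixed point of the limiting recursion. -/
theorem riccati_tendsto_of_bounded (hQ : Q.PosDef) (hS : S.PosSemidef) (hP : P.PosDef)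
    (hfix : riccati A Q S P = P) {S' X : ℕ → Matrix n n ℝ} (hS' : ∀ k, (S' k).PosSemidef)
    (hlim : Tendsto S' atTop (𝓝 S)) (hX : ∀ k, (X k).PosDef)
    (hstep : ∀ k, X (k + 1) = riccati A Q (S' k) (X k))
    (hb : ∃ T, ∀ᶠ k in atTop, ∀ v, qform (X k) v ≤ T * qform P v) :
    Tendsto X atTop (𝓝 P) := by
  obtain ⟨c', hc', hc'Q⟩ := hQ.exists_qform_le P
  set c := (c' + 1)⁻¹ with hcdef
  have hc0 : 0 < c := by positivity
  have hc1 : c < 1 := by rw [hcdef]; exact inv_lt_one_of_one_lt₀ (by linarith)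
  have hcQ : ∀ v, c * qform P v ≤ qform Q v := fun v => by
    rw [hcdef, inv_mul_le_iff₀ (by linarith)]
    nlinarith [hc'Q v, hQ.qform_nonneg v]
  have hρ0 : 0 < 1 - c / 2 := by linarith
  have hρ1 : 1 - c / 2 < 1 := by linarith
  have small : ∀ (e : ℝ) (f : ℝ → ℝ), 0 < e → ContinuousAt f 0 → f 0 = 1 + e →
      ∃ δ, 0 < δ ∧ δ * (1 + e) < 1 ∧ (1 - c) * (f δ - 1) ≤ (1 - c / 2) * e := by
    intro e f he hf hf0
    have h1 : Tendsto (fun δ => (1 - c) * (f δ - 1)) (𝓝 0) (𝓝 ((1 - c) * e)) := by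
      have := (hf.tendsto.sub_const 1).const_mul (1 - c)
      rwa [hf0, add_sub_cancel_left] at this
    have h2 : ∀ᶠ δ in 𝓝 (0 : ℝ), (1 - c) * (f δ - 1) < (1 - c / 2) * e :=
      h1.eventually (gt_mem_nhds (by nlinarith))
    have h3 : ∀ᶠ δ in 𝓝 (0 : ℝ), δ * (1 + e) < 1 := by
      have : Tendsto (fun δ : ℝ => δ * (1 + e)) (𝓝 0) (𝓝 (0 * (1 + e))) :=
        (continuous_id.mul continuous_const).tendsto 0
      exact this.eventually (gt_mem_nhds (by simp))
    obtain ⟨δ, ⟨h4, h5⟩, h6⟩ := (((h2.and h3).filter_mono nhdsWithin_le_nhds).and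
      (self_mem_nhdsWithin (s := Set.Ioi (0 : ℝ)))).exists
    exact ⟨δ, h6, h5, h4.le⟩
  have upper : ∀ ε, 0 < ε → ∀ᶠ k in atTop, ∀ v, qform (X k) v ≤ (1 + ε) * qform P v := by
    intro ε hε
    refine eventually_of_contraction
      (p := fun k e => ∀ v, qform (X k) v ≤ (1 + e) * qform P v) hρ0 hρ1 ?_ ?_ ?_ hε
    · intro k e e' hee' h v
      exact (h v).trans (mul_le_mul_of_nonneg_right (by linarith) (hP.qform_nonneg v))
    · intro e he
      obtain ⟨δ, hδ, hδ1, hδ2⟩ := small e (fun δ => (1 + e) / (1 - δ * (1 + e))) he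
        (ContinuousAt.div (by fun_prop) (by fun_prop) (by simp)) (by simp)
      filter_upwards [hP.inv.eventually_abs_qform_sub_le hlim hδ] with k hk h v
      rw [hstep]
      refine (riccati_contraction_upper hS hP hfix hcQ (hS' k) (hX k) hδ.le hk
        (by linarith) hδ1 h v).trans (mul_le_mul_of_nonneg_right ?_ (hP.qform_nonneg v))
      linarith
    · obtain ⟨T, hT⟩ := hb
      refine ⟨|T| + 1, by positivity, ?_⟩
      filter_upwards [hT] with k hk v
      exact (hk v).trans (mul_le_mul_of_nonneg_right (by linarith [le_abs_self T])
        (hP.qform_nonneg v))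
  have lower : ∀ ε, 0 < ε → ∀ᶠ k in atTop, ∀ v, qform P v ≤ (1 + ε) * qform (X k) v := by
    intro ε hε
    refine eventually_of_contraction
      (p := fun k e => ∀ v, qform P v ≤ (1 + e) * qform (X k) v) hρ0 hρ1 ?_ ?_ ?_ hε
    · intro k e e' hee' h v
      exact (h v).trans (mul_le_mul_of_nonneg_right (by linarith) ((hX k).qform_nonneg v))
    · intro e he
      obtain ⟨δ, hδ, hδ1, hδ2⟩ := small e (fun δ => 1 + e + δ) he (by fun_prop) (by simp)
      filter_upwards [hP.inv.eventually_abs_qform_sub_le hlim hδ] with k hk h v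
      have hX1 := (hX (k + 1)).qform_nonneg v
      rw [hstep] at hX1 ⊢
      refine (riccati_contraction_lower hQ hS hP hfix hc0.le hc1.le hcQ (hS' k) (hX k) hδ.le hk
        (by linarith) h v).trans (mul_le_mul_of_nonneg_right ?_ hX1)
      linarith
    · refine ⟨c', hc', eventually_atTop_of_succ (Eventually.of_forall fun k v => ?_)⟩
      have h1 := qform_le_qform_riccati (Q := Q) A (hS' k) (hX k) v
      rw [← hstep] at h1
      have h2 := mul_le_mul_of_nonneg_left h1 hc'.le
      linarith [hc'Q v, (hX (k + 1)).qform_nonneg v]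
  refine tendsto_of_qform (fun k => (hX k).1) hP.1 fun v => Metric.tendsto_atTop'.2 fun ε hε => ?_
  set e := ε / (qform P v + 1) with he
  have hv := hP.qform_nonneg v
  have he0 : 0 < e := by positivity
  have hev : e * qform P v < ε := by
    rw [he, div_mul_eq_mul_div, div_lt_iff₀ (by linarith)]; nlinarith
  obtain ⟨a, ha⟩ := eventually_atTop.1 ((upper e he0).and (lower e he0))
  refine ⟨a, fun k hk => ?_⟩
  obtain ⟨h1, h2⟩ := ha k hk.le
  have h1 := h1 v
  have h2 := h2 v
  have h3 : (1 - e) * qform P v ≤ qform (X k) v := by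
    by_cases h1e : e ≤ 1
    · have := mul_le_mul_of_nonneg_left h2 (sub_nonneg.2 h1e)
      nlinarith [(hX k).qform_nonneg v, mul_nonneg (sq_nonneg e) ((hX k).qform_nonneg v)]
    · nlinarith [(hX k).qform_nonneg v]
  rw [Real.dist_eq, abs_lt]
  constructor <;> linarith

end Riccati

section Boundedness

variable {n p : Type*} [Fintype n] [Fintype p]

/-- The span of the ranges of `(Aᵀ)ⁱ Cᵀ` for `i < m`. -/
def reachable (A : Matrix n n ℝ) (C : Matrix p n ℝ) : ℕ → Submodule ℝ (n → ℝ)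
  | 0 => ⊥
  | m + 1 => LinearMap.range Cᵀ.mulVecLin ⊔ (reachable A C m).map Aᵀ.mulVecLin

theorem reachable_le_succ (A : Matrix n n ℝ) (C : Matrix p n ℝ) (m : ℕ) :
    reachable A C m ≤ reachable A C (m + 1) := by
  induction m with
  | zero => exact bot_le
  | succ m ih => exact sup_le_sup_left (Submodule.map_mono ih) _

variable [DecidableEq n]

/-- Observability of `(A, C)` is controllability of `(Aᵀ, Cᵀ)`. -/
theorem Observable.exists_reachable_eq_top {A : Matrix n n ℝ} {C : Matrix p n ℝ}
    (h : Observable A C) : ∃ m, reachable A C m = ⊤ := by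
  obtain ⟨m, hm⟩ := monotone_stabilizes_iff_noetherian.2
    (inferInstance : IsNoetherian ℝ (n → ℝ))
    ⟨reachable A C, monotone_nat_of_le_succ (reachable_le_succ A C)⟩
  have hm' : reachable A C (m + 1) = reachable A C m := (hm (m + 1) (Nat.le_succ m)).symm
  refine ⟨m, ?_⟩
  by_contra hne
  obtain ⟨f, hf0, hf⟩ := Submodule.exists_le_ker_of_lt_top _ (lt_top_iff_ne_top.2 hne)
  obtain ⟨x, hx⟩ : ∃ x : n → ℝ, ∀ y, f y = x ⬝ᵥ y := by
    refine ⟨fun i => f (Pi.single i 1), fun y => ?_⟩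
    conv_lhs => rw [pi_eq_sum_univ' y]
    simp only [map_sum, map_smul, smul_eq_mul, dotProduct]
    refine Finset.sum_congr rfl fun i _ => ?_
    rw [mul_comm]
  have hmem : ∀ (k : ℕ) (u : p → ℝ), (Aᵀ ^ k) *ᵥ (Cᵀ *ᵥ u) ∈ reachable A C m := by
    intro k u
    induction k with
    | zero =>
      rw [← hm']
      exact Submodule.mem_sup_left ⟨u, by rw [pow_zero, Matrix.one_mulVec, Matrix.mulVecLin_apply]⟩
    | succ k ih =>
      rw [← hm']
      refine Submodule.mem_sup_right ⟨_, ih, ?_⟩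
      rw [Matrix.mulVecLin_apply, Matrix.mulVec_mulVec, ← pow_succ']
  have hx0 : x = 0 := by
    refine h x fun k => ?_
    have h1 : ∀ u, (C *ᵥ (A ^ k *ᵥ x)) ⬝ᵥ u = 0 := fun u => by
      have h2 : f _ = 0 := hf (hmem k u)
      rw [hx, ← Matrix.transpose_pow, Matrix.dotProduct_mulVec, Matrix.vecMul_transpose,
        Matrix.dotProduct_mulVec, Matrix.vecMul_transpose] at h2
      exact h2
    exact dotProduct_self_eq_zero.1 (h1 _)
  exact hf0 (LinearMap.ext fun y => by rw [hx, hx0, zero_dotProduct, LinearMap.zero_apply])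

variable {A Q : Matrix n n ℝ}

/-- Observability bounds the trajectories of the Riccati recursion. -/
theorem Observable.exists_eventually_qform_le {C : Matrix p n ℝ} (hobs : Observable A C)
    {S X : ℕ → Matrix n n ℝ} (hS : ∀ k, (S k).PosSemidef) (hX : ∀ k, (X k).PosDef)
    (hstep : ∀ k, X (k + 1) = riccati A Q (S k) (X k)) {r : ℝ}
    (hC : ∀ᶠ k in atTop, ∀ u z, 2 * (u ⬝ᵥ C *ᵥ z) ≤ qform (S k) z + r * (u ⬝ᵥ u))
    (x : n → ℝ) : ∃ c, ∀ᶠ k in atTop, qform (X k) x ≤ c := by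
  let V : Submodule ℝ (n → ℝ) :=
    { carrier := {x | ∃ c, ∀ᶠ k in atTop, qform (X k) x ≤ c}
      zero_mem' := ⟨0, Eventually.of_forall fun k => by simp [qform]⟩
      add_mem' := by
        rintro v w ⟨c, hc⟩ ⟨d, hd⟩
        refine ⟨2 * c + 2 * d, ?_⟩
        filter_upwards [hc, hd] with k h1 h2
        have h3 := (hX k).qform_nonneg (v - w)
        rw [qform_sub_vec (hX k).1] at h3
        rw [qform_add_vec (hX k).1]
        linarith
      smul_mem' := by
        rintro a v ⟨c, hc⟩
        refine ⟨a ^ 2 * c, ?_⟩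
        filter_upwards [hc] with k h1
        rw [qform_smul_vec]
        exact mul_le_mul_of_nonneg_left h1 (sq_nonneg a) }
  have back : ∀ (x : n → ℝ) (u : p → ℝ), Aᵀ *ᵥ x - Cᵀ *ᵥ u ∈ V → x ∈ V := by
    rintro x u ⟨c, hc⟩
    refine ⟨c + r * (u ⬝ᵥ u) + qform Q x, eventually_atTop_of_succ ?_⟩
    filter_upwards [hc, hC] with k h1 h2
    rw [hstep]
    linarith [qform_riccati_le A Q (hS k) (hX k) h2 x u]
  have key : ∀ (j : ℕ) (x : n → ℝ), (Aᵀ ^ j) *ᵥ x ∈ V ⊔ reachable A C j → x ∈ V := by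
    intro j
    induction j with
    | zero => intro x hx; simpa [reachable] using hx
    | succ j ih =>
      intro x hx
      refine ih x ?_
      obtain ⟨v, hv, y, hy, hvy⟩ := Submodule.mem_sup.1 hx
      obtain ⟨_, ⟨u, rfl⟩, _, ⟨w, hw, rfl⟩, rfl⟩ := Submodule.mem_sup.1 hy
      refine Submodule.mem_sup.2 ⟨(Aᵀ ^ j) *ᵥ x - w, back _ u ?_, w, hw, by simp⟩
      have : Aᵀ *ᵥ ((Aᵀ ^ j) *ᵥ x - w) - Cᵀ *ᵥ u = v := by
        rw [Matrix.mulVec_sub, Matrix.mulVec_mulVec, ← pow_succ', ← hvy]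
        simp only [Matrix.mulVecLin_apply]
        abel
      rw [this]; exact hv
  obtain ⟨m, hm⟩ := hobs.exists_reachable_eq_top
  exact key m x (by rw [hm]; simp)

theorem Observable.exists_eventually_forall_qform_le {C : Matrix p n ℝ} (hobs : Observable A C)
    {S X : ℕ → Matrix n n ℝ} (hS : ∀ k, (S k).PosSemidef) (hX : ∀ k, (X k).PosDef)
    (hstep : ∀ k, X (k + 1) = riccati A Q (S k) (X k)) {r : ℝ}
    (hC : ∀ᶠ k in atTop, ∀ u z, 2 * (u ⬝ᵥ C *ᵥ z) ≤ qform (S k) z + r * (u ⬝ᵥ u))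
    {B : Matrix n n ℝ} (hB : B.PosDef) :
    ∃ T, ∀ᶠ k in atTop, ∀ v, qform (X k) v ≤ T * qform B v := by
  choose c hc using fun a : n =>
    hobs.exists_eventually_qform_le hS hX hstep hC (Pi.single a 1)
  obtain ⟨b, hb, hbB⟩ := hB.exists_dotProduct_self_le
  refine ⟨|∑ a, ∑ a', (c a + c a') / 2| * b, ?_⟩
  filter_upwards [eventually_all.2 hc] with k hk v
  have hd : ∀ a, X k a a ≤ c a := fun a => by simpa [qform] using hk a
  calc qform (X k) v ≤ (∑ a, ∑ a', (X k a a + X k a' a') / 2) * (v ⬝ᵥ v) :=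
        (hX k).posSemidef.qform_le_sum_diag v
    _ ≤ |∑ a, ∑ a', (c a + c a') / 2| * (v ⬝ᵥ v) := by
        refine mul_le_mul_of_nonneg_right (le_trans ?_ (le_abs_self _))
          (dotProduct_self_nonneg' v)
        gcongr with a _ a' _
        · exact hd a
        · exact hd a'
    _ ≤ |∑ a, ∑ a', (c a + c a') / 2| * (b * qform B v) := by
        gcongr; exact hbB v
    _ = _ := by ring

theorem continuousAt_riccati (A Q : Matrix n n ℝ) {S P : Matrix n n ℝ} (hS : S.PosSemidef)
    (hP : P.PosDef) : ContinuousAt (riccati A Q S) P := by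
  have hinv : ∀ M : Matrix n n ℝ, M.PosDef → ContinuousAt (fun X : Matrix n n ℝ => X⁻¹) M := by
    intro M hM
    refine continuousAt_matrix_inv M ?_
    rw [Ring.inverse_eq_inv']
    exact continuousAt_inv₀ hM.det_pos.ne'
  have h1 : ContinuousAt (fun X : Matrix n n ℝ => (X⁻¹ + S)⁻¹) P :=
    ContinuousAt.comp (f := fun X : Matrix n n ℝ => X⁻¹ + S)
      (g := fun X : Matrix n n ℝ => X⁻¹) (hinv _ (hP.inv_add hS))
      ((hinv P hP).add continuousAt_const)
  have h2 : Continuous fun Z : Matrix n n ℝ => A * Z * Aᵀ + Q := by fun_prop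
  exact h2.continuousAt.comp h1

/-- The algebraic Riccati equation of an observable pair has a positive definite solution. -/
theorem Observable.exists_riccati_fixedPoint {C : Matrix p n ℝ} (hobs : Observable A C)
    (hQ : Q.PosDef) {S : Matrix n n ℝ} (hS : S.PosSemidef) {r : ℝ}
    (hC : ∀ u z, 2 * (u ⬝ᵥ C *ᵥ z) ≤ qform S z + r * (u ⬝ᵥ u)) :
    ∃ P : Matrix n n ℝ, P.PosDef ∧ riccati A Q S P = P := by
  let X : ℕ → Matrix n n ℝ := fun k => (riccati A Q S)^[k] Q
  have hstep : ∀ k, X (k + 1) = riccati A Q S (X k) := fun k =>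
    Function.iterate_succ_apply' _ _ _
  have hX : ∀ k, (X k).PosDef := fun k => by
    induction k with
    | zero => exact hQ
    | succ k ih => rw [hstep]; exact riccati_posDef A hQ hS ih
  have hmono : ∀ k v, qform (X k) v ≤ qform (X (k + 1)) v := fun k => by
    induction k with
    | zero => rw [hstep]; exact qform_le_qform_riccati A hS hQ
    | succ k ih =>
      intro v
      have := qform_riccati_mono A Q hS (hX k) (hX (k + 1)) ih v
      rwa [← hstep, ← hstep] at this
  have hm : ∀ v, Monotone fun k => qform (X k) v := fun v =>
    monotone_nat_of_le_succ fun k => hmono k v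
  have hconv : ∀ v, ∃ g, Tendsto (fun k => qform (X k) v) atTop (𝓝 g) := fun v => by
    obtain ⟨c, hc⟩ := hobs.exists_eventually_qform_le (fun _ => hS) hX hstep
      (Eventually.of_forall fun _ => hC) v
    refine ⟨_, tendsto_atTop_ciSup (hm v) ⟨c, ?_⟩⟩
    rintro _ ⟨k, rfl⟩
    obtain ⟨j, hj, hkj⟩ := (hc.and (eventually_ge_atTop k)).exists
    exact (hm v hkj).trans hj
  choose g hg using hconv
  let P : Matrix n n ℝ := fun a b =>
    (g (Pi.single a 1 + Pi.single b 1) - g (Pi.single a 1) - g (Pi.single b 1)) / 2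
  have hlim : Tendsto X atTop (𝓝 P) :=
    tendsto_pi_nhds.2 fun a => tendsto_pi_nhds.2 fun b => by
      simp_rw [fun k => entry_eq_qform (hX k).1 a b]
      exact (((hg _).sub (hg _)).sub (hg _)).div_const 2
  have hherm : P.IsHermitian := by
    refine Matrix.IsHermitian.ext fun a b => ?_
    change (g (Pi.single b 1 + Pi.single a 1) - g (Pi.single b 1) - g (Pi.single a 1)) / 2
      = (g (Pi.single a 1 + Pi.single b 1) - g (Pi.single a 1) - g (Pi.single b 1)) / 2
    rw [add_comm (Pi.single b 1 : n → ℝ)]; ring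
  have hP : P.PosDef := posDef_of_le_qform hQ hherm fun v =>
    ge_of_tendsto' (((continuous_qform v).tendsto P).comp hlim) fun k => hm v (Nat.zero_le k)
  refine ⟨P, hP, tendsto_nhds_unique ?_ (hlim.comp (tendsto_add_atTop_nat 1))⟩
  have := (continuousAt_riccati A Q hS hP).tendsto.comp hlim
  exact this.congr fun k => (hstep k).symm

end Boundedness

/-! ### Convergence of Moore-Penrose inverses -/

section MoorePenrose

variable {n p : Type*} [Fintype n] [DecidableEq n] [Fintype p]

theorem IsMoorePenrose.pinv_eq {a b : Type*} [Fintype a] [Fintype b]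
    {M : Matrix a b ℝ} {X : Matrix b a ℝ} (h : IsMoorePenrose M X) : pinv M = X :=
  (pinv_spec M).unique h

theorem pinv_eq_inv {M : Matrix n n ℝ} (h : IsUnit M.det) : pinv M = M⁻¹ := by
  have h1 := Matrix.mul_nonsing_inv M h
  have h2 := Matrix.nonsing_inv_mul M h
  exact IsMoorePenrose.pinv_eq ⟨by rw [h1, one_mul], by rw [h2, one_mul], by rw [h1]; simp,
    by rw [h2]; simp⟩

theorem Matrix.IsHermitian.transpose_eq {n : Type*} {M : Matrix n n ℝ} (hM : M.IsHermitian) :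
    Mᵀ = M := by
  simpa using hM.eq

theorem pinv_transpose {n : Type*} [Fintype n] {M : Matrix n n ℝ} (hM : M.IsHermitian) :
    (pinv M)ᵀ = pinv M := by
  have h := pinv_spec M
  have hT := hM.transpose_eq
  refine (IsMoorePenrose.pinv_eq ⟨?_, ?_, ?_, ?_⟩).symm
  · simpa [hT, Matrix.mul_assoc] using congrArg Matrix.transpose h.mul_mul_self
  · simpa [hT, Matrix.mul_assoc] using congrArg Matrix.transpose h.self_mul_mul
  · have := h.symm_right
    rw [Matrix.transpose_mul, hT] at this
    rw [this, Matrix.transpose_mul, hT, this]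
  · have := h.symm_left
    rw [Matrix.transpose_mul, hT] at this
    rw [this, Matrix.transpose_mul, hT, this]

theorem pinv_mul_comm {n : Type*} [Fintype n] {M : Matrix n n ℝ} (hM : M.IsHermitian) :
    pinv M * M = M * pinv M := by
  have := (pinv_spec M).symm_left
  rwa [Matrix.transpose_mul, hM.transpose_eq, pinv_transpose hM] at this

theorem pinv_posSemidef {n : Type*} [Fintype n] {M : Matrix n n ℝ} (hM : M.PosSemidef) :
    (pinv M).PosSemidef := by
  have h := hM.mul_mul_conjTranspose_same (pinv M)
  rwa [Matrix.conjTranspose_eq_transpose_of_trivial, pinv_transpose hM.1,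
    (pinv_spec M).self_mul_mul] at h

/-- The orthogonal projection onto the kernel of a symmetric matrix. -/
noncomputable def kerProj (R : Matrix n n ℝ) : Matrix n n ℝ := 1 - R * pinv R

theorem mul_kerProj {R : Matrix n n ℝ} (hR : R.IsHermitian) : R * kerProj R = 0 := by
  rw [kerProj, ← pinv_mul_comm hR, Matrix.mul_sub, Matrix.mul_one, ← Matrix.mul_assoc,
    (pinv_spec R).mul_mul_self, sub_self]

theorem kerProj_transpose (R : Matrix n n ℝ) : (kerProj R)ᵀ = kerProj R := by
  rw [kerProj, Matrix.transpose_sub, (pinv_spec R).symm_left, Matrix.transpose_one]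

theorem kerProj_mul_self (R : Matrix n n ℝ) : kerProj R * kerProj R = kerProj R := by
  have h : R * pinv R * (R * pinv R) = R * pinv R := by
    rw [← Matrix.mul_assoc, (pinv_spec R).mul_mul_self]
  simp only [kerProj, Matrix.sub_mul, Matrix.mul_sub, Matrix.one_mul, Matrix.mul_one, h]
  simp

theorem isUnit_det_add_kerProj {R : Matrix n n ℝ} (hR : R.IsHermitian) :
    IsUnit (R + kerProj R).det := by
  refine Matrix.isUnit_det_of_right_inverse (B := pinv R + kerProj R) ?_
  have h : kerProj R * pinv R = 0 := by
    rw [kerProj, ← pinv_mul_comm hR, Matrix.sub_mul, Matrix.one_mul,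
      (pinv_spec R).self_mul_mul, sub_self]
  rw [Matrix.add_mul, Matrix.mul_add, Matrix.mul_add, mul_kerProj hR, h, kerProj_mul_self,
    kerProj]
  simp

theorem isMoorePenrose_of_mul_kerProj {R U : Matrix n n ℝ} (hU : U.IsHermitian)
    (h0 : U * kerProj R = 0) (hdet : IsUnit (U + kerProj R).det) :
    IsMoorePenrose U ((U + kerProj R)⁻¹ - kerProj R) ∧
      U * ((U + kerProj R)⁻¹ - kerProj R) = R * pinv R := by
  set E := kerProj R with hE
  have hEE : E * E = E := kerProj_mul_self R
  have hET : Eᵀ = E := kerProj_transpose R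
  have h0' : E * U = 0 := by
    simpa [hET, hU.transpose_eq] using congrArg Matrix.transpose h0
  set V := (U + E)⁻¹ with hV
  have h1 : (U + E) * V = 1 := Matrix.mul_nonsing_inv _ hdet
  have h2 : V * (U + E) = 1 := Matrix.nonsing_inv_mul _ hdet
  have hVE : V * E = E := by
    have : (U + E) * E = E := by rw [Matrix.add_mul, h0, hEE, zero_add]
    calc V * E = V * (U + E) * E := by rw [Matrix.mul_assoc, this]
      _ = E := by rw [h2, Matrix.one_mul]
  have hEV : E * V = E := by
    have : E * (U + E) = E := by rw [Matrix.mul_add, h0', hEE, zero_add]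
    calc E * V = E * (U + E) * V := by rw [this]
      _ = E := by rw [Matrix.mul_assoc, h1, Matrix.mul_one]
  have hUX : U * (V - E) = 1 - E := by
    rw [Matrix.add_mul, hEV] at h1
    rw [Matrix.mul_sub, h0, sub_zero, ← h1, add_sub_cancel_right]
  have hXU : (V - E) * U = 1 - E := by
    rw [Matrix.mul_add, hVE] at h2
    rw [Matrix.sub_mul, h0', sub_zero, ← h2, add_sub_cancel_right]
  have hsymm : (1 - E)ᵀ = 1 - E := by rw [Matrix.transpose_sub, hET, Matrix.transpose_one]
  refine ⟨⟨?_, ?_, by rw [hUX, hsymm], by rw [hXU, hsymm]⟩, ?_⟩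
  · rw [hUX, Matrix.sub_mul, h0', Matrix.one_mul, sub_zero]
  · rw [hXU, Matrix.sub_mul, Matrix.one_mul, Matrix.mul_sub, hEV, hEE, sub_self, sub_zero]
  · rw [hUX, hE, kerProj, sub_sub_cancel]

theorem tendsto_matrix_inv {ι : Type*} {l : Filter ι} {M : ι → Matrix n n ℝ} {M' : Matrix n n ℝ}
    (h : Tendsto M l (𝓝 M')) (hM' : IsUnit M'.det) :
    Tendsto (fun k => (M k)⁻¹) l (𝓝 M'⁻¹) := by
  refine (continuousAt_matrix_inv M' ?_).tendsto.comp h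
  rw [Ring.inverse_eq_inv']
  exact continuousAt_inv₀ hM'.ne_zero

theorem eventually_isUnit_det {ι : Type*} {l : Filter ι} {M : ι → Matrix n n ℝ}
    {M' : Matrix n n ℝ} (h : Tendsto M l (𝓝 M')) (hM' : IsUnit M'.det) :
    ∀ᶠ k in l, IsUnit (M k).det := by
  have h1 : Tendsto (fun k => (M k).det) l (𝓝 M'.det) :=
    (Continuous.matrix_det continuous_id).continuousAt.tendsto.comp h
  exact (h1.eventually_ne hM'.ne_zero).mono fun k hk => isUnit_iff_ne_zero.2 hk

variable {ι : Type*} {l : Filter ι} {U : ι → Matrix n n ℝ} {R : Matrix n n ℝ}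

theorem eventually_isMoorePenrose (hR : R.IsHermitian) (hU : ∀ k, (U k).IsHermitian)
    (h0 : ∀ k, U k * kerProj R = 0) (hlim : Tendsto U l (𝓝 R)) :
    ∀ᶠ k in l, pinv (U k) = (U k + kerProj R)⁻¹ - kerProj R ∧
      U k * pinv (U k) = R * pinv R := by
  filter_upwards [eventually_isUnit_det (hlim.add_const (kerProj R))
    (isUnit_det_add_kerProj hR)] with k hk
  obtain ⟨h1, h2⟩ := isMoorePenrose_of_mul_kerProj (hU k) (h0 k) hk
  rw [h1.pinv_eq]
  exact ⟨rfl, h2⟩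

/-- The Moore-Penrose inverse is continuous along symmetric matrices whose kernel contains the
kernel of the limit. -/
theorem tendsto_pinv (hR : R.IsHermitian) (hU : ∀ k, (U k).IsHermitian)
    (h0 : ∀ k, U k * kerProj R = 0) (hlim : Tendsto U l (𝓝 R)) :
    Tendsto (fun k => pinv (U k)) l (𝓝 (pinv R)) := by
  have hRR := (isMoorePenrose_of_mul_kerProj hR (mul_kerProj hR)
    (isUnit_det_add_kerProj hR)).1.pinv_eq
  rw [hRR]
  refine ((tendsto_matrix_inv (hlim.add_const (kerProj R))
    (isUnit_det_add_kerProj hR)).sub_const (kerProj R)).congr' ?_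
  filter_upwards [eventually_isMoorePenrose hR hU h0 hlim] with k hk using hk.1.symm

theorem two_mul_dotProduct_le_of_pinv {n : Type*} [Fintype n] {U : Matrix n n ℝ} (hU : U.PosSemidef)
    {C : Matrix n p ℝ} (hC : U * pinv U * C = C) (u : n → ℝ) (z : p → ℝ) :
    2 * (u ⬝ᵥ C *ᵥ z) ≤ qform (Cᵀ * pinv U * C) z + qform U u := by
  have h := hU.qform_nonneg (u - pinv U *ᵥ (C *ᵥ z))
  rw [qform_sub_vec hU.1, Matrix.mulVec_mulVec, Matrix.mulVec_mulVec, hC] at h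
  have h1 : qform U (pinv U *ᵥ (C *ᵥ z)) = qform (Cᵀ * pinv U * C) z := by
    have h2 := qform_conj (pinv U) Cᵀ z
    have h3 := qform_conj U (pinv U) (C *ᵥ z)
    rw [pinv_transpose hU.1, (pinv_spec U).self_mul_mul] at h3
    rw [Matrix.transpose_transpose] at h2
    rw [h2, h3]
  rw [h1] at h
  linarith

theorem conj_pinv_posSemidef {n : Type*} [Fintype n] {U : Matrix n n ℝ} (hU : U.PosSemidef) (C : Matrix n p ℝ) :
    (Cᵀ * pinv U * C).PosSemidef := by
  simpa using (pinv_posSemidef hU).conjTranspose_mul_mul_same C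

end MoorePenrose

section RiccatiEstimated

variable {n p : Type*} [Fintype n] [DecidableEq n] [Fintype p] [DecidableEq p]

/-- The Riccati recursion with a consistent sequence of estimates of the noise covariance `R`
converges to the unique positive definite solution of the algebraic Riccati equation. -/
theorem Observable.exists_riccati_limit {A Q : Matrix n n ℝ} {C : Matrix p n ℝ}
    {R : Matrix p p ℝ} (hobs : Observable A C) (hQ : Q.PosDef) (hR : R.PosSemidef)
    (hC : R * pinv R * C = C) :
    ∃ P : Matrix n n ℝ, P.PosDef ∧ riccati A Q (Cᵀ * pinv R * C) P = P ∧
      (∀ P' : Matrix n n ℝ, P'.PosDef → riccati A Q (Cᵀ * pinv R * C) P' = P' → P' = P) ∧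
      ∀ (U : ℕ → Matrix p p ℝ) (X : ℕ → Matrix n n ℝ), (∀ k, (U k).PosSemidef) →
        (∀ k, U k * kerProj R = 0) → Tendsto U atTop (𝓝 R) → (X 0).PosDef →
        (∀ k, X (k + 1) = riccati A Q (Cᵀ * pinv (U k) * C) (X k)) →
        Tendsto X atTop (𝓝 P) := by
  have hS := conj_pinv_posSemidef hR C
  have hone : (1 : Matrix p p ℝ).PosDef := Matrix.PosDef.one
  have h1 : ∀ u : p → ℝ, qform 1 u = u ⬝ᵥ u := fun u => by simp [qform]
  obtain ⟨r, hr, hrR⟩ := hone.exists_qform_le R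
  simp_rw [h1] at hrR
  obtain ⟨P, hP, hfix⟩ := hobs.exists_riccati_fixedPoint (r := r) hQ hS fun u z =>
    (two_mul_dotProduct_le_of_pinv hR hC u z).trans (by gcongr; exact hrR u)
  have main : ∀ (U : ℕ → Matrix p p ℝ) (X : ℕ → Matrix n n ℝ), (∀ k, (U k).PosSemidef) →
        (∀ k, U k * kerProj R = 0) → Tendsto U atTop (𝓝 R) → (X 0).PosDef →
        (∀ k, X (k + 1) = riccati A Q (Cᵀ * pinv (U k) * C) (X k)) →
        Tendsto X atTop (𝓝 P) := by
    intro U X hU h0 hlim hX0 hstep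
    have hSk : ∀ k, (Cᵀ * pinv (U k) * C).PosSemidef := fun k => conj_pinv_posSemidef (hU k) C
    have hX : ∀ k, (X k).PosDef := fun k => by
      induction k with
      | zero => exact hX0
      | succ k ih => rw [hstep]; exact riccati_posDef A hQ (hSk k) ih
    have hpinv := tendsto_pinv hR.1 (fun k => (hU k).1) h0 hlim
    have hcont : Continuous fun M : Matrix p p ℝ => Cᵀ * M * C := by fun_prop
    refine riccati_tendsto_of_bounded hQ hS hP hfix hSk ((hcont.tendsto _).comp hpinv) hX hstep
      (hobs.exists_eventually_forall_qform_le hSk hX hstep (r := r + 1) ?_ hP)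
    filter_upwards [eventually_isMoorePenrose hR.1 (fun k => (hU k).1) h0 hlim,
      hone.eventually_abs_qform_sub_le hlim one_pos] with k hk hk' u z
    refine (two_mul_dotProduct_le_of_pinv (hU k) (by rw [hk.2, hC]) u z).trans ?_
    have h2 := (abs_le.1 (hk' u)).2
    rw [h1] at h2
    linarith [hrR u]
  refine ⟨P, hP, hfix, fun P' hP' hfix' => ?_, main⟩
  exact tendsto_nhds_unique tendsto_const_nhds (main (fun _ => R) (fun _ => P') (fun _ => hR)
    (fun _ => mul_kerProj hR.1) tendsto_const_nhds hP' fun _ => hfix'.symm)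

end RiccatiEstimated

/-! ### Consensus -/

section Consensus

variable {N : ℕ} {L : Matrix (Fin N) (Fin N) ℝ}

theorem fuse_eq_sum {V : Type*} [AddCommMonoid V] [Module ℝ V]
    (L : Matrix (Fin N) (Fin N) ℝ) (m : ℕ) (Z : Fin N → V) (i : Fin N) :
    fuse L m Z i = ∑ j, (L ^ m) i j • Z j := by
  induction m generalizing i with
  | zero => simp [fuse, Matrix.one_apply, ite_smul]
  | succ m ih =>
    simp only [fuse, ih, Finset.smul_sum, smul_smul]
    rw [Finset.sum_comm]
    simp only [pow_succ', Matrix.mul_apply, Finset.sum_smul]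

theorem IsConsensusWeight.pow_pos_of_walk {G : SimpleGraph (Fin N)} (h : IsConsensusWeight G L)
    {i j : Fin N} (w : G.Walk i j) : ∀ᶠ k in atTop, 0 < (L ^ k) i j := by
  have hnn : ∀ k a b, 0 ≤ (L ^ k) a b := fun k =>
    (mem_doublyStochastic_iff_sum.1 (pow_mem h.doublyStochastic k)).1
  have hstep : ∀ k a b c, 0 < L a b → 0 < (L ^ k) b c → 0 < (L ^ (k + 1)) a c := by
    intro k a b c h1 h2
    rw [pow_succ', Matrix.mul_apply]
    refine (mul_pos h1 h2).trans_le (Finset.single_le_sum (f := fun x => L a x * (L ^ k) x c)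
      (fun x _ => mul_nonneg ?_ (hnn k x c)) (Finset.mem_univ b))
    simpa using hnn 1 a x
  induction w with
  | nil =>
    rename_i a
    refine Eventually.of_forall fun k => ?_
    induction k with
    | zero => simp
    | succ k ih => exact hstep k a a a (h.diag_pos a) ih
  | cons hadj _ ih =>
    refine eventually_atTop_of_succ ?_
    filter_upwards [ih] with k hk using hstep k _ _ _ (h.pos_of_adj _ _ hadj) hk

/-- The powers of a doubly stochastic matrix with some positive power converge to the averaging
matrix. -/
theorem tendsto_pow_of_mem_doublyStochastic (hL : L ∈ doublyStochastic ℝ (Fin N)) {K : ℕ}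
    (hK : ∀ i j, 0 < (L ^ K) i j) (i j : Fin N) :
    Tendsto (fun k => (L ^ k) i j) atTop (𝓝 (N : ℝ)⁻¹) := by
  have hN : 0 < (N : ℝ) := Nat.cast_pos.2 i.pos
  have hds := fun k => mem_doublyStochastic_iff_sum.1 (pow_mem hL k)
  obtain ⟨ε, hε, hεK⟩ : ∃ ε, 0 < ε ∧ ∀ a b, ε ≤ (L ^ K) a b := by
    obtain ⟨p, -, hp⟩ := Finset.exists_min_image (Finset.univ : Finset (Fin N × Fin N))
      (fun p => (L ^ K) p.1 p.2) ⟨(i, j), Finset.mem_univ _⟩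
    exact ⟨_, hK p.1 p.2, fun a b => hp (a, b) (Finset.mem_univ _)⟩
  let D : ℕ → Fin N → ℝ := fun k a => (L ^ k) a j - (N : ℝ)⁻¹
  let s : ℕ → ℝ := fun k => ∑ a, |D k a|
  have hs0 : ∀ k, 0 ≤ s k := fun k => Finset.sum_nonneg fun a _ => abs_nonneg _
  have hD0 : ∀ k, ∑ a, D k a = 0 := fun k => by
    simp only [D, Finset.sum_sub_distrib, (hds k).2.2 j]
    simp [hN.ne']
  have hadd : ∀ r k a, D (r + k) a = ∑ b, (L ^ r) a b * D k b := fun r k a => by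
    simp only [D, mul_sub, Finset.sum_sub_distrib, ← Finset.sum_mul, (hds r).2.1 a, one_mul,
      pow_add, Matrix.mul_apply]
  have bound : ∀ r k δ, (∀ a b, δ ≤ (L ^ r) a b) → s (r + k) ≤ (1 - N * δ) * s k := by
    intro r k δ hδ
    have h1 : ∀ a, |D (r + k) a| ≤ ∑ b, ((L ^ r) a b - δ) * |D k b| := fun a => by
      have : D (r + k) a = ∑ b, ((L ^ r) a b - δ) * D k b := by
        simp only [sub_mul, Finset.sum_sub_distrib, ← Finset.mul_sum, hD0, hadd]
        ring
      rw [this]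
      refine (Finset.abs_sum_le_sum_abs _ _).trans (Finset.sum_le_sum fun b _ => ?_)
      rw [abs_mul, abs_of_nonneg (sub_nonneg.2 (hδ a b))]
    refine (Finset.sum_le_sum fun a _ => h1 a).trans ?_
    rw [Finset.sum_comm]
    simp only [← Finset.sum_mul, Finset.sum_sub_distrib, (hds r).2.2]
    simp [s, Finset.mul_sum]
  have hanti : Antitone s := antitone_nat_of_succ_le fun k => by
    have := bound 1 k 0 (hds 1).1
    simpa [add_comm] using this
  have hlim := tendsto_atTop_ciInf hanti ⟨0, by rintro _ ⟨k, rfl⟩; exact hs0 k⟩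
  set l := ⨅ k, s k
  have hl0 : 0 ≤ l := ge_of_tendsto' hlim hs0
  have hl : l ≤ (1 - N * ε) * l := by
    have h1 : Tendsto (fun k => s (K + k)) atTop (𝓝 l) := by
      simpa [add_comm] using (tendsto_add_atTop_iff_nat K).2 hlim
    exact le_of_tendsto_of_tendsto' h1 (hlim.const_mul _) fun k => bound K k ε hεK
  have hl1 : l = 0 := by
    have : 0 < N * ε := by positivity
    nlinarith
  rw [hl1] at hlim
  have h3 : Tendsto (fun k => D k i) atTop (𝓝 0) :=
    squeeze_zero_norm (fun k => by
      rw [Real.norm_eq_abs]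
      exact Finset.single_le_sum (f := fun a => |D k a|) (fun a _ => abs_nonneg _)
        (Finset.mem_univ i)) hlim
  simpa [D] using h3.add_const (N : ℝ)⁻¹

theorem IsConsensusWeight.tendsto_pow {G : SimpleGraph (Fin N)} (hG : G.Connected)
    (h : IsConsensusWeight G L) (i j : Fin N) :
    Tendsto (fun k => (L ^ k) i j) atTop (𝓝 (N : ℝ)⁻¹) := by
  have h1 : ∀ᶠ k in atTop, ∀ a b, 0 < (L ^ k) a b :=
    eventually_all.2 fun a => eventually_all.2 fun b =>
      h.pow_pos_of_walk (hG.preconnected a b).some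
  obtain ⟨K, hK⟩ := h1.exists
  exact tendsto_pow_of_mem_doublyStochastic h.doublyStochastic hK i j

theorem IsConsensusWeight.pow_nonneg {G : SimpleGraph (Fin N)}
    (h : IsConsensusWeight G L) (k : ℕ) (i j : Fin N) : 0 ≤ (L ^ k) i j :=
  (mem_doublyStochastic_iff_sum.1 (pow_mem h.doublyStochastic k)).1 i j

end Consensus

theorem posSemidef_sum_smul {ι n : Type*} [Fintype ι] [Fintype n] {c : ι → ℝ}
    {M : ι → Matrix n n ℝ} (hc : ∀ j, 0 ≤ c j) (hM : ∀ j, (M j).PosSemidef) :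
    (∑ j, c j • M j).PosSemidef :=
  Matrix.posSemidef_sum _ fun j _ => (hM j).smul (hc j)

theorem posSemidef_vecMulVec_self {n : Type*} [Fintype n] (v : n → ℝ) :
    (Matrix.vecMulVec v v).PosSemidef := by
  simpa using Matrix.posSemidef_vecMulVec_self_star v

namespace FilterData

variable {N n : ℕ} {m : Fin N → ℕ} {D : FilterData N n m}

theorem info_posSemidef (hR : ∀ i, (D.R i).PosDef) (j : Fin N) : (D.info j).PosSemidef := by
  simpa [info] using (hR j).inv.posSemidef.conjTranspose_mul_mul_same (D.C j)

theorem Ctilde_eq (D : FilterData N n m) (i : Fin N) :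
    D.Ctilde i = ∑ j, (D.L ^ D.γ) i j • D.info j :=
  fuse_eq_sum _ _ _ _

theorem Rtilde_posSemidef (hR : ∀ i, (D.R i).PosDef) (i : Fin N) : (D.Rtilde i).PosSemidef :=
  posSemidef_sum_smul (fun _ => sq_nonneg _) (info_posSemidef hR)

/-- The kernel of `R̃ᵢ` lies in the kernels of all the fused information matrices. -/
theorem weight_smul_info_mul_kerProj (hR : ∀ i, (D.R i).PosDef) (i j : Fin N) :
    (D.L ^ D.γ) i j • (D.info j * kerProj (D.Rtilde i)) = 0 := by
  rw [smul_eq_zero, or_iff_not_imp_left]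
  intro hw
  refine Matrix.ext_of_mulVec_single fun a => ?_
  rw [Matrix.zero_mulVec, ← Matrix.mulVec_mulVec]
  set z := kerProj (D.Rtilde i) *ᵥ Pi.single a 1
  have h0 : qform (D.Rtilde i) z = 0 := by
    rw [qform, Matrix.mulVec_mulVec, mul_kerProj (Rtilde_posSemidef hR i).1,
      Matrix.zero_mulVec, dotProduct_zero]
  have h1 : qform (D.Rtilde i) z = ∑ l, (D.L ^ D.γ) i l ^ 2 * qform (D.info l) z := by
    simp [qform, Rtilde, Matrix.sum_mulVec, dotProduct_sum, Matrix.smul_mulVec]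
  rw [h1, Finset.sum_eq_zero_iff_of_nonneg fun l _ =>
    mul_nonneg (sq_nonneg _) ((info_posSemidef hR l).qform_nonneg z)] at h0
  have h2 := (mul_eq_zero.1 (h0 j (Finset.mem_univ j))).resolve_left (pow_ne_zero 2 hw)
  exact ((info_posSemidef hR j).dotProduct_mulVec_zero_iff z).1 (by simpa [qform] using h2)

theorem weight_smul_factor_mul_kerProj (hR : ∀ i, (D.R i).PosDef)
    {Y : Fin N → Matrix (Fin n) (Fin n) ℝ} (hY : ∀ j, (Y j)ᵀ * Y j = D.info j) (i j : Fin N) :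
    (D.L ^ D.γ) i j • (Y j * kerProj (D.Rtilde i)) = 0 := by
  have h := weight_smul_info_mul_kerProj hR i j
  rw [smul_eq_zero] at h ⊢
  refine h.imp_right fun h => ?_
  rw [← hY, Matrix.mul_assoc] at h
  rw [← Matrix.mul_assoc] at h
  exact (Matrix.conjTranspose_mul_self_mul_eq_zero (Y j) _).1 (by simpa using h)

theorem Ctilde_transpose (hR : ∀ i, (D.R i).PosDef) (i : Fin N) :
    (D.Ctilde i)ᵀ = D.Ctilde i := by
  simp only [Ctilde_eq, Matrix.transpose_sum, Matrix.transpose_smul,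
    (info_posSemidef hR _).1.transpose_eq]

theorem Rtilde_mul_pinv_mul_Ctilde (hR : ∀ i, (D.R i).PosDef) (i : Fin N) :
    D.Rtilde i * pinv (D.Rtilde i) * D.Ctilde i = D.Ctilde i := by
  have h1 : D.Ctilde i * kerProj (D.Rtilde i) = 0 := by
    simp only [Ctilde_eq, Matrix.sum_mul, Matrix.smul_mul, weight_smul_info_mul_kerProj hR,
      Finset.sum_const_zero]
  have h2 := congrArg Matrix.transpose h1
  rw [Matrix.transpose_mul, kerProj_transpose, Ctilde_transpose hR, Matrix.transpose_zero,
    kerProj, Matrix.sub_mul, Matrix.one_mul, sub_eq_zero] at h2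
  exact h2.symm

section Direct

variable {Y : Fin N → Matrix (Fin n) (Fin n) ℝ} {q : Matrix (Fin N) (Fin N) ℝ}

theorem utilde_eq (D : FilterData N n m) (Y : Fin N → Matrix (Fin n) (Fin n) ℝ)
    (q : Matrix (Fin N) (Fin N) ℝ) (i : Fin N) :
    D.utilde Y q i = ∑ j, (D.L ^ D.γ) i j • ((Y j)ᵀ * rowKron (n := n) (q j)) :=
  fuse_eq_sum _ _ _ _

theorem utilde_transpose_mul_kerProj (hR : ∀ i, (D.R i).PosDef)
    (hY : ∀ j, (Y j)ᵀ * Y j = D.info j) (q : Matrix (Fin N) (Fin N) ℝ) (i : Fin N) :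
    (D.utilde Y q i)ᵀ * kerProj (D.Rtilde i) = 0 := by
  simp only [utilde_eq, Matrix.transpose_sum, Matrix.transpose_smul, Matrix.transpose_mul,
    Matrix.transpose_transpose, Matrix.sum_mul, Matrix.smul_mul, Matrix.mul_assoc]
  refine Finset.sum_eq_zero fun j _ => ?_
  rw [← Matrix.mul_smul, weight_smul_factor_mul_kerProj hR hY, Matrix.mul_zero]

theorem direct_W_eq (x₀ : Fin n → ℝ) (P₀ : Matrix (Fin n) (Fin n) ℝ)
    (Y : Fin N → Matrix (Fin n) (Fin n) ℝ) (q : Matrix (Fin N) (Fin N) ℝ)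
    (y : ℕ → (i : Fin N) → Fin (m i) → ℝ) (k : ℕ) (i : Fin N) :
    (D.direct x₀ P₀ Y q y k).W i =
      ∑ j, (D.L ^ (D.γ * k)) i j • ((N : ℝ) • Matrix.vecMulVec (q j) (q j)) := by
  induction k generalizing i with
  | zero => simp [direct, Matrix.one_apply, ite_smul]
  | succ k ih =>
    have : (D.direct x₀ P₀ Y q y (k + 1)).W i =
      fuse D.L D.γ (D.direct x₀ P₀ Y q y k).W i := rfl
    rw [this, fuse_eq_sum]
    simp only [ih, Finset.smul_sum]
    rw [Finset.sum_comm]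
    simp only [smul_smul, Nat.mul_succ, add_comm (D.γ * k), pow_add, Matrix.mul_apply,
      Finset.sum_mul, Finset.sum_smul, mul_assoc]

theorem tendsto_direct_W {G : SimpleGraph (Fin N)} (hG : G.Connected)
    (hL : IsConsensusWeight G D.L) (hγ : 1 ≤ D.γ) (x₀ : Fin n → ℝ)
    (P₀ : Matrix (Fin n) (Fin n) ℝ) (Y : Fin N → Matrix (Fin n) (Fin n) ℝ)
    (q : Matrix (Fin N) (Fin N) ℝ) (y : ℕ → (i : Fin N) → Fin (m i) → ℝ) (i : Fin N) :
    Tendsto (fun k => (D.direct x₀ P₀ Y q y k).W i) atTop (𝓝 (qᵀ * q)) := by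
  have hN : (N : ℝ) ≠ 0 := Nat.cast_ne_zero.2 i.pos.ne'
  have hlim : qᵀ * q = ∑ j, (N : ℝ)⁻¹ • ((N : ℝ) • Matrix.vecMulVec (q j) (q j)) := by
    ext a b
    simp [Matrix.mul_apply, Matrix.sum_apply, Matrix.vecMulVec_apply, hN]
  rw [hlim]
  simp only [direct_W_eq]
  refine tendsto_finsetSum _ fun j _ => Tendsto.smul_const ?_ _
  exact (hL.tendsto_pow hG i j).comp (tendsto_id.const_mul_atTop' hγ)

theorem rowKron_mul_kronecker_mul (q q' : Fin N → ℝ) (g : Matrix (Fin N) (Fin N) ℝ) :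
    rowKron (n := n) q * (g ⊗ₖ (1 : Matrix (Fin n) (Fin n) ℝ)) * (rowKron (n := n) q')ᵀ =
      (q ⬝ᵥ g *ᵥ q') • (1 : Matrix (Fin n) (Fin n) ℝ) := by
  have h : ∀ (q : Fin N → ℝ) (a : Fin n) (b : Fin N × Fin n),
      rowKron (n := n) q a b = q b.1 * (1 : Matrix (Fin n) (Fin n) ℝ) a b.2 := fun q a b => by
    simp [rowKron, Matrix.kroneckerMap_apply]
  ext a c
  simp only [Matrix.mul_apply, Matrix.transpose_apply, h, Matrix.kroneckerMap_apply,
    Fintype.sum_prod_type, Matrix.smul_apply, smul_eq_mul, dotProduct, Matrix.mulVec,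
    Matrix.one_apply]
  simp [Finset.mul_sum, Finset.sum_mul]
  rw [Finset.sum_comm]
  simp only [mul_assoc]

theorem utilde_mul_inv_mul (hY : ∀ j, (Y j)ᵀ * Y j = D.info j) (hq : q.det ≠ 0) (i : Fin N) :
    D.utilde Y q i * ((qᵀ * q) ⊗ₖ (1 : Matrix (Fin n) (Fin n) ℝ))⁻¹ * (D.utilde Y q i)ᵀ =
      D.Rtilde i := by
  have hu : IsUnit q.det := isUnit_iff_ne_zero.2 hq
  have hg : ∀ j l, q j ⬝ᵥ (qᵀ * q)⁻¹ *ᵥ q l = (1 : Matrix (Fin N) (Fin N) ℝ) j l := by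
    intro j l
    have h1 : q * (qᵀ * q)⁻¹ * qᵀ = 1 := by
      rw [Matrix.mul_inv_rev, ← Matrix.mul_assoc, Matrix.mul_nonsing_inv _ hu, Matrix.one_mul,
        Matrix.nonsing_inv_mul _ (by rwa [Matrix.det_transpose])]
    rw [← h1, Matrix.mul_assoc, Matrix.mul_apply]
    simp [dotProduct, Matrix.mulVec, Matrix.mul_apply]
  rw [Matrix.inv_kronecker, inv_one]
  simp only [utilde_eq, Matrix.transpose_sum, Matrix.transpose_smul, Matrix.transpose_mul,
    Matrix.transpose_transpose, Matrix.sum_mul, Matrix.mul_sum, Matrix.smul_mul,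
    Matrix.mul_smul]
  have h2 : ∀ j l, (Y j)ᵀ * rowKron (n := n) (q j) *
      ((qᵀ * q)⁻¹ ⊗ₖ (1 : Matrix (Fin n) (Fin n) ℝ)) *
      ((rowKron (n := n) (q l))ᵀ * Y l) =
      (1 : Matrix (Fin N) (Fin N) ℝ) j l • ((Y j)ᵀ * Y l) := by
    intro j l
    calc _ = (Y j)ᵀ * (rowKron (n := n) (q j) *
        ((qᵀ * q)⁻¹ ⊗ₖ (1 : Matrix (Fin n) (Fin n) ℝ)) *
        (rowKron (n := n) (q l))ᵀ) * Y l := by simp only [Matrix.mul_assoc]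
      _ = _ := by
        rw [rowKron_mul_kronecker_mul, hg, Matrix.mul_smul, Matrix.mul_one, Matrix.smul_mul]
  simp only [h2, Rtilde]
  refine Finset.sum_congr rfl fun j _ => ?_
  simp [Matrix.one_apply, ite_smul, hY, smul_smul, sq]

theorem tendsto_Utilde {G : SimpleGraph (Fin N)} (hG : G.Connected)
    (hL : IsConsensusWeight G D.L) (hγ : 1 ≤ D.γ) (x₀ : Fin n → ℝ)
    (P₀ : Matrix (Fin n) (Fin n) ℝ) (hY : ∀ j, (Y j)ᵀ * Y j = D.info j) (hq : q.det ≠ 0)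
    (y : ℕ → (i : Fin N) → Fin (m i) → ℝ) (i : Fin N) :
    Tendsto (fun k => D.Utilde Y q (D.direct x₀ P₀ Y q y k).W i) atTop (𝓝 (D.Rtilde i)) := by
  have hu : IsUnit ((qᵀ * q) ⊗ₖ (1 : Matrix (Fin n) (Fin n) ℝ)).det := by
    rw [isUnit_iff_ne_zero, Matrix.det_kronecker]
    simp [hq]
  have hkron : Continuous fun W : Matrix (Fin N) (Fin N) ℝ =>
      W ⊗ₖ (1 : Matrix (Fin n) (Fin n) ℝ) := by
    refine continuous_matrix fun a b => ?_
    simp only [Matrix.kroneckerMap_apply]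
    fun_prop
  have h1 := (hkron.tendsto _).comp (tendsto_direct_W hG hL hγ x₀ P₀ Y q y i)
  have h2 := (tendsto_matrix_inv h1 hu).congr'
    ((eventually_isUnit_det h1 hu).mono fun k hk => (pinv_eq_inv hk).symm)
  rw [← utilde_mul_inv_mul hY hq i]
  have h3 : Continuous fun Z : Matrix (Fin N × Fin n) (Fin N × Fin n) ℝ =>
    D.utilde Y q i * Z * (D.utilde Y q i)ᵀ := by fun_prop
  exact (h3.tendsto _).comp h2

theorem Utilde_posSemidef {W : Fin N → Matrix (Fin N) (Fin N) ℝ} {i : Fin N}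
    (hW : (W i).PosSemidef) : (D.Utilde Y q W i).PosSemidef := by
  simpa [Utilde] using (pinv_posSemidef (hW.kronecker
    (Matrix.PosSemidef.one (n := Fin n) (R := ℝ)))).mul_mul_conjTranspose_same (D.utilde Y q i)

theorem direct_W_posSemidef {G : SimpleGraph (Fin N)} (hL : IsConsensusWeight G D.L)
    (x₀ : Fin n → ℝ) (P₀ : Matrix (Fin n) (Fin n) ℝ) (y : ℕ → (i : Fin N) → Fin (m i) → ℝ)
    (k : ℕ) (i : Fin N) : ((D.direct x₀ P₀ Y q y k).W i).PosSemidef := by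
  rw [direct_W_eq]
  exact posSemidef_sum_smul (fun j => hL.pow_nonneg _ _ _) fun j =>
    (posSemidef_vecMulVec_self (q j)).smul (Nat.cast_nonneg N)

theorem directPrior_succ (x₀ : Fin n → ℝ) (P₀ : Matrix (Fin n) (Fin n) ℝ)
    (y : ℕ → (i : Fin N) → Fin (m i) → ℝ) (i : Fin N) (k : ℕ) :
    D.directPrior x₀ P₀ Y q y i (k + 1) =
      riccati D.A D.Q ((D.Ctilde i)ᵀ *
        pinv (D.Utilde Y q (D.direct x₀ P₀ Y q y (k + 1)).W i) * D.Ctilde i)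
        (D.directPrior x₀ P₀ Y q y i k) := rfl

end Direct

theorem predictCov_posDef (hQ : D.Q.PosDef) {P : Matrix (Fin n) (Fin n) ℝ} (hP : P.PosDef) :
    (D.predictCov P).PosDef := by
  have h := hP.posSemidef.mul_mul_conjTranspose_same D.A
  exact hQ.posSemidef_add (by simpa using h)

section Stochastic

variable {Y : Fin N → Matrix (Fin n) (Fin n) ℝ}

theorem upsilon_eq (D : FilterData N n m) (Y : Fin N → Matrix (Fin n) (Fin n) ℝ)
    (θ : Fin N → Fin n → ℝ) (i : Fin N) :
    D.upsilon Y θ i = ∑ j, (D.L ^ D.γ) i j • ((Y j)ᵀ *ᵥ θ j) :=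
  fuse_eq_sum _ _ _ _

theorem upsilon_vecMul_kerProj (hR : ∀ i, (D.R i).PosDef)
    (hY : ∀ j, (Y j)ᵀ * Y j = D.info j) (θ : Fin N → Fin n → ℝ) (i : Fin N) :
    D.upsilon Y θ i ᵥ* kerProj (D.Rtilde i) = 0 := by
  rw [← Matrix.mulVec_transpose, upsilon_eq, Matrix.mulVec_sum]
  refine Finset.sum_eq_zero fun j _ => ?_
  have h := congrArg Matrix.transpose (weight_smul_factor_mul_kerProj hR hY i j)
  rw [Matrix.transpose_smul, Matrix.transpose_mul, Matrix.transpose_zero] at h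
  rw [Matrix.mulVec_smul, Matrix.mulVec_mulVec, ← Matrix.smul_mulVec, h, Matrix.zero_mulVec]

theorem stoch_Ups_eq (x₀ : Fin n → ℝ) (P₀ : Matrix (Fin n) (Fin n) ℝ)
    (θ : ℕ → Fin N → Fin n → ℝ) (y : ℕ → (i : Fin N) → Fin (m i) → ℝ) (k : ℕ) (i : Fin N) :
    (D.stoch x₀ P₀ Y θ y k).Ups i = (k : ℝ)⁻¹ • ∑ s ∈ Finset.range k,
      Matrix.vecMulVec (D.upsilon Y (θ (s + 1)) i) (D.upsilon Y (θ (s + 1)) i) := by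
  induction k with
  | zero => simp [stoch]
  | succ k ih =>
    have : (D.stoch x₀ P₀ Y θ y (k + 1)).Ups i =
      ((((k + 1 : ℕ) : ℝ) - 1) / (k + 1 : ℕ)) • (D.stoch x₀ P₀ Y θ y k).Ups i +
      (1 / ((k + 1 : ℕ) : ℝ)) •
        Matrix.vecMulVec (D.upsilon Y (θ (k + 1)) i) (D.upsilon Y (θ (k + 1)) i) := rfl
    rw [this, ih, Finset.sum_range_succ, smul_add, smul_smul, one_div]
    rcases k.eq_zero_or_pos with rfl | hk
    · simp
    · congr 2
      have : (k : ℝ) ≠ 0 := by positivity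
      push_cast
      field_simp
      simp

theorem stoch_Ups_posSemidef (x₀ : Fin n → ℝ) (P₀ : Matrix (Fin n) (Fin n) ℝ)
    (θ : ℕ → Fin N → Fin n → ℝ) (y : ℕ → (i : Fin N) → Fin (m i) → ℝ) (k : ℕ) (i : Fin N) :
    ((D.stoch x₀ P₀ Y θ y k).Ups i).PosSemidef := by
  rw [stoch_Ups_eq]
  exact (Matrix.posSemidef_sum _ fun s _ => posSemidef_vecMulVec_self _).smul (by positivity)

theorem stoch_Ups_mul_kerProj (hR : ∀ i, (D.R i).PosDef)
    (hY : ∀ j, (Y j)ᵀ * Y j = D.info j) (x₀ : Fin n → ℝ) (P₀ : Matrix (Fin n) (Fin n) ℝ)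
    (θ : ℕ → Fin N → Fin n → ℝ) (y : ℕ → (i : Fin N) → Fin (m i) → ℝ) (k : ℕ) (i : Fin N) :
    (D.stoch x₀ P₀ Y θ y k).Ups i * kerProj (D.Rtilde i) = 0 := by
  rw [stoch_Ups_eq, Matrix.smul_mul, Matrix.sum_mul, Finset.sum_eq_zero, smul_zero]
  intro s _
  rw [Matrix.vecMulVec_mul, upsilon_vecMul_kerProj hR hY, Matrix.vecMulVec_zero]

theorem stochPrior_succ (x₀ : Fin n → ℝ) (P₀ : Matrix (Fin n) (Fin n) ℝ)
    (θ : ℕ → Fin N → Fin n → ℝ) (y : ℕ → (i : Fin N) → Fin (m i) → ℝ) (i : Fin N) (k : ℕ) :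
    D.stochPrior x₀ P₀ Y θ y i (k + 1) =
      riccati D.A D.Q ((D.Ctilde i)ᵀ *
        pinv ((D.stoch x₀ P₀ Y θ y (k + 1)).Ups i) * D.Ctilde i)
        (D.stochPrior x₀ P₀ Y θ y i k) := rfl

end Stochastic

end FilterData

/-! ### Gaussian samples -/

section Gaussian

theorem pi_fin_absolutelyContinuous {α : Type*} [MeasurableSpace α] {μ ν : Measure α}
    [SigmaFinite μ] [SigmaFinite ν] (h : μ ≪ ν) (d : ℕ) :
    Measure.pi (fun _ : Fin d => μ) ≪ Measure.pi (fun _ : Fin d => ν) := by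
  induction d with
  | zero => rw [Measure.pi_of_empty, Measure.pi_of_empty]
  | succ d ih =>
    rw [← (measurePreserving_piFinSuccAbove (fun _ : Fin (d + 1) => μ) 0).symm.map_eq,
      ← (measurePreserving_piFinSuccAbove (fun _ : Fin (d + 1) => ν) 0).symm.map_eq]
    exact (h.prod ih).map (MeasurableEquiv.measurable _)

theorem pi_absolutelyContinuous {ι α : Type*} [Fintype ι] [MeasurableSpace α] {μ ν : Measure α}
    [SigmaFinite μ] [SigmaFinite ν] (h : μ ≪ ν) :
    Measure.pi (fun _ : ι => μ) ≪ Measure.pi (fun _ : ι => ν) := by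
  have e := (Fintype.equivFin ι).symm
  rw [← (measurePreserving_piCongrLeft (fun _ : ι => μ) e).map_eq,
    ← (measurePreserving_piCongrLeft (fun _ : ι => ν) e).map_eq]
  exact (pi_fin_absolutelyContinuous h _).map (MeasurableEquiv.measurable _)

/-- Almost every real matrix is invertible. -/
theorem ae_det_ne_zero (N : ℕ) :
    ∀ᵐ M : Fin N × Fin N → ℝ, (Matrix.of fun a b => M (a, b)).det ≠ 0 := by
  let L : ℝ →ₗ[ℝ] (Fin N × Fin N → ℝ) :=
    LinearMap.toSpanSingleton ℝ _ fun p => (1 : Matrix (Fin N) (Fin N) ℝ) p.1 p.2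
  have hdet : Continuous fun M : Fin N × Fin N → ℝ =>
      (Matrix.of fun a b => M (a, b)).det :=
    Continuous.matrix_det (continuous_matrix fun a b => by
      simp only [Matrix.of_apply]; fun_prop)
  refine ae_mem_of_ae_add_linearMap_mem L volume volume
    (s := {M | (Matrix.of fun a b => M (a, b)).det ≠ 0})
    (hdet.isOpen_preimage _ isOpen_ne).measurableSet fun M => ?_
  set M' : Matrix (Fin N) (Fin N) ℝ := Matrix.of fun a b => M (a, b) with hM'
  have hfin : ((-M').charpoly.roots.toFinset : Set ℝ).Finite := Finset.finite_toSet _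
  refine measure_mono_null (fun t ht => ?_) (hfin.measure_zero volume)
  have h1 : (Matrix.of fun a b => (M + L t) (a, b)) = Matrix.scalar (Fin N) t - -M' := by
    ext a b
    simp [L, hM', Matrix.one_apply, Matrix.diagonal_apply, add_comm]
  have h2 : (Matrix.of fun a b => (M + L t) (a, b)).det = 0 := by simpa using ht
  rw [h1, ← Matrix.eval_charpoly] at h2
  simpa [(Matrix.charpoly_monic _).ne_zero] using h2

variable {Ω : Type*} [MeasurableSpace Ω] {μ : Measure Ω} [IsProbabilityMeasure μ]

theorem ae_det_ne_zero_of_gaussian {N : ℕ} {q : Ω → Matrix (Fin N) (Fin N) ℝ}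
    (hq : ∀ j l, HasLaw (fun ω => q ω j l) (gaussianReal 0 1) μ)
    (hind : iIndepFun (fun (p : Fin N × Fin N) ω => q ω p.1 p.2) μ) :
    ∀ᵐ ω ∂μ, (q ω).det ≠ 0 := by
  have hm : ∀ p : Fin N × Fin N, AEMeasurable (fun ω => q ω p.1 p.2) μ :=
    fun p => (hq p.1 p.2).aemeasurable
  have hlaw := (iIndepFun_iff_map_fun_eq_pi_map hm).1 hind
  simp only [fun p : Fin N × Fin N => (hq p.1 p.2).map_eq] at hlaw
  have h1 := (pi_absolutelyContinuous (ι := Fin N × Fin N)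
    (gaussianReal_absolutelyContinuous 0 one_ne_zero)).ae_le (ae_det_ne_zero N)
  rw [← hlaw] at h1
  exact ae_of_ae_map (aemeasurable_pi_lambda _ hm) h1

/-- Empirical second moments of independent standard Gaussian families, linearly combined. -/
theorem ae_tendsto_average_vecMulVec {N n : ℕ} {θ : ℕ → Fin N → Ω → Fin n → ℝ}
    (hθ : ∀ k j, HasLaw (θ k j) (Measure.pi fun _ : Fin n => gaussianReal 0 1) μ)
    (hind : iIndepFun (fun p : ℕ × Fin N => θ p.1 p.2) μ)
    (B : Fin N → Matrix (Fin n) (Fin n) ℝ) :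
    ∀ᵐ ω ∂μ, Tendsto (fun k : ℕ => (k : ℝ)⁻¹ • ∑ s ∈ Finset.range k,
      Matrix.vecMulVec (∑ j, B j *ᵥ θ s j ω) (∑ j, B j *ᵥ θ s j ω)) atTop
      (𝓝 (∑ j, B j * (B j)ᵀ)) := by
  set γ : Measure ℝ := gaussianReal 0 1
  have hm : ∀ k j, AEMeasurable (θ k j) μ := fun k j => (hθ k j).aemeasurable
  have hmc : ∀ k j c, AEMeasurable (fun ω => θ k j ω c) μ := fun k j c =>
    (measurable_pi_apply c).comp_aemeasurable (hm k j)
  have hlaw : ∀ k j c, HasLaw (fun ω => θ k j ω c) γ μ := fun k j c =>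
    ⟨hmc k j c, by
      have h1 := AEMeasurable.map_map_of_aemeasurable (g := fun v : Fin n → ℝ => v c)
        (measurable_pi_apply c).aemeasurable (hm k j)
      rw [(hθ k j).map_eq, (measurePreserving_eval (fun _ : Fin n => γ) c).map_eq] at h1
      exact h1.symm⟩
  have hL2 : ∀ k j c, MemLp (fun ω => θ k j ω c) 2 μ := fun k j c => by
    have h1 : MemLp (id : ℝ → ℝ) 2 (μ.map fun ω => θ k j ω c) := by
      rw [(hlaw k j c).map_eq]; exact memLp_id_gaussianReal 2
    exact h1.comp_of_map (hmc k j c)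
  have hmean : ∀ k j c, ∫ ω, θ k j ω c ∂μ = 0 := fun k j c => by
    rw [(hlaw k j c).integral_eq]; exact integral_id_gaussianReal
  have hindc : ∀ k (p p' : Fin N × Fin n), p ≠ p' →
      IndepFun (fun ω => θ k p.1 ω p.2) (fun ω => θ k p'.1 ω p'.2) μ := by
    rintro k ⟨j, c⟩ ⟨j', c'⟩ hne
    by_cases hj : j = j'
    · subst hj
      have hc : c ≠ c' := fun h => hne (by rw [h])
      have h1 : iIndepFun (fun c ω => θ k j ω c) μ :=
        (iIndepFun_iff_map_fun_eq_pi_map (hmc k j)).2 (by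
          simp only [(hlaw k j _).map_eq]; exact (hθ k j).map_eq)
      exact h1.indepFun hc
    · exact (hind.indepFun (i := (k, j)) (j := (k, j')) (by simpa using hj)).comp
        (measurable_pi_apply c) (measurable_pi_apply c')
  have hcov : ∀ k (p p' : Fin N × Fin n),
      ∫ ω, θ k p.1 ω p.2 * θ k p'.1 ω p'.2 ∂μ = if p = p' then 1 else 0 := by
    intro k p p'
    split_ifs with h
    · subst h
      have h1 : Var[id; γ] = 1 := by simp [γ]
      rw [variance_eq_integral aemeasurable_id] at h1
      have h2 := (hlaw k p.1 p.2).integral_comp (f := fun x : ℝ => x * x)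
        (by fun_prop)
      simp only [Function.comp_def] at h2
      rw [h2]
      simpa [γ, sq] using h1
    · have h1 := (hindc k p p' h).integral_fun_mul_eq_mul_integral
        (hmc k p.1 p.2).aestronglyMeasurable (hmc k p'.1 p'.2).aestronglyMeasurable
      rw [h1, hmean, zero_mul]
  let f : Fin n → Fin n → (Fin N → Fin n → ℝ) → ℝ := fun a b t =>
    (∑ p : Fin N × Fin n, B p.1 a p.2 * t p.1 p.2) *
      ∑ p : Fin N × Fin n, B p.1 b p.2 * t p.1 p.2
  have hf : ∀ a b, Measurable (f a b) := fun a b => by fun_prop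
  have hint : ∀ a b, Integrable (fun ω => f a b fun j => θ 0 j ω) μ := fun a b => by
    refine MemLp.integrable_mul (p := 2) (q := 2) ?_ ?_ <;>
      exact memLp_finsetSum _ fun p _ => (hL2 0 p.1 p.2).const_mul _
  have hval : ∀ a b, ∫ ω, f a b (fun j => θ 0 j ω) ∂μ = (∑ j, B j * (B j)ᵀ) a b := by
    intro a b
    simp only [f, Finset.sum_mul_sum]
    have hi : ∀ p p' : Fin N × Fin n, Integrable (fun ω => B p.1 a p.2 * θ 0 p.1 ω p.2 *
        (B p'.1 b p'.2 * θ 0 p'.1 ω p'.2)) μ := fun p p' =>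
      MemLp.integrable_mul (p := 2) (q := 2) ((hL2 0 p.1 p.2).const_mul _)
        ((hL2 0 p'.1 p'.2).const_mul _)
    rw [integral_finsetSum _ fun p _ => integrable_finsetSum _ fun p' _ => hi p p']
    simp_rw [fun p => integral_finsetSum Finset.univ fun p' _ => hi p p']
    have hv : ∀ p p' : Fin N × Fin n, ∫ ω, B p.1 a p.2 * θ 0 p.1 ω p.2 *
        (B p'.1 b p'.2 * θ 0 p'.1 ω p'.2) ∂μ =
          if p = p' then B p.1 a p.2 * B p'.1 b p'.2 else 0 := by
      intro p p'
      have : ∀ ω, B p.1 a p.2 * θ 0 p.1 ω p.2 * (B p'.1 b p'.2 * θ 0 p'.1 ω p'.2) =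
        (B p.1 a p.2 * B p'.1 b p'.2) * (θ 0 p.1 ω p.2 * θ 0 p'.1 ω p'.2) := fun ω => by ring
      simp_rw [this, integral_const_mul, hcov, mul_ite, mul_one, mul_zero]
    simp only [hv, Finset.sum_ite_eq, Finset.mem_univ, if_true, Fintype.sum_prod_type,
      Matrix.sum_apply, Matrix.mul_apply, Matrix.transpose_apply]
  have hmblock : ∀ k, AEMeasurable (fun ω j => θ k j ω) μ := fun k =>
    aemeasurable_pi_lambda _ (hm k)
  have hblock : ∀ k, μ.map (fun ω j => θ k j ω) =
      Measure.pi fun _ : Fin N => Measure.pi fun _ : Fin n => γ := fun k => by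
    have h1 : iIndepFun (θ k) μ :=
      hind.precomp (g := fun j => (k, j)) fun _ _ h => (Prod.ext_iff.1 h).2
    rw [(iIndepFun_iff_map_fun_eq_pi_map (hm k)).1 h1]
    simp only [(hθ k _).map_eq, γ]
  have hident : ∀ k, IdentDistrib (fun ω j => θ k j ω) (fun ω j => θ 0 j ω) μ μ := fun k =>
    ⟨hmblock k, hmblock 0, by rw [hblock, hblock]⟩
  have hindblock : Pairwise fun k k' =>
      IndepFun (fun ω j => θ k j ω) (fun ω j => θ k' j ω) μ := by
    intro k k' hkk
    let S : ℕ → Finset (ℕ × Fin N) := fun k => Finset.univ.image fun j => (k, j)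
    have hS : ∀ k j, (k, j) ∈ S k := fun k j => by simp [S]
    have hdisj : Disjoint (S k) (S k') := Finset.disjoint_left.2 fun p hp hp' => by
      simp only [S, Finset.mem_image, Finset.mem_univ, true_and] at hp hp'
      obtain ⟨_, rfl⟩ := hp
      obtain ⟨_, h⟩ := hp'
      exact hkk (Prod.ext_iff.1 h).1.symm
    have h1 := hind.indepFun_finset₀ (S k) (S k') hdisj fun p => hm p.1 p.2
    exact h1.comp (φ := fun t j => t ⟨(k, j), hS k j⟩) (ψ := fun t j => t ⟨(k', j), hS k' j⟩)
      (by fun_prop) (by fun_prop)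
  have hslln : ∀ a b, ∀ᵐ ω ∂μ, Tendsto (fun k : ℕ =>
      (∑ s ∈ Finset.range k, f a b fun j => θ s j ω) / k) atTop
      (𝓝 ((∑ j, B j * (B j)ᵀ) a b)) := fun a b => by
    rw [← hval]
    exact strong_law_ae_real (fun k ω => f a b fun j => θ k j ω) (hint a b)
      (fun k k' hkk => (hindblock hkk).comp (hf a b) (hf a b))
      fun k => (hident k).comp (hf a b)
  filter_upwards [ae_all_iff.2 fun a => ae_all_iff.2 fun b => hslln a b] with ω hω
  refine tendsto_pi_nhds.2 fun a => tendsto_pi_nhds.2 fun b => (hω a b).congr fun k => ?_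
  rw [Matrix.smul_apply, Matrix.sum_apply, smul_eq_mul, div_eq_inv_mul]
  congr 1
  refine Finset.sum_congr rfl fun s _ => ?_
  simp only [f, Matrix.vecMulVec_apply, Finset.sum_apply, Matrix.mulVec, dotProduct,
    Fintype.sum_prod_type]

end Gaussian

namespace FilterData

variable {N n : ℕ} {m : Fin N → ℕ} {D : FilterData N n m}

theorem DARE_iff (i : Fin N) (P : Matrix (Fin n) (Fin n) ℝ) :
    D.DARE i P ↔
      riccati D.A D.Q ((D.Ctilde i)ᵀ * pinv (D.Rtilde i) * D.Ctilde i) P = P :=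
  eq_comm

theorem Utilde_mul_kerProj (hR : ∀ i, (D.R i).PosDef) {Y : Fin N → Matrix (Fin n) (Fin n) ℝ}
    (hY : ∀ j, (Y j)ᵀ * Y j = D.info j) (q : Matrix (Fin N) (Fin N) ℝ)
    (W : Fin N → Matrix (Fin N) (Fin N) ℝ) (i : Fin N) :
    D.Utilde Y q W i * kerProj (D.Rtilde i) = 0 := by
  rw [Utilde, Matrix.mul_assoc, utilde_transpose_mul_kerProj hR hY, Matrix.mul_zero]

theorem ae_tendsto_stoch_Ups {Ω : Type*} [MeasurableSpace Ω] {μ : Measure Ω}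
    [IsProbabilityMeasure μ] (x₀ : Fin n → ℝ) (P₀ : Matrix (Fin n) (Fin n) ℝ)
    {Y : Fin N → Matrix (Fin n) (Fin n) ℝ} (hY : ∀ j, (Y j)ᵀ * Y j = D.info j)
    {θ : ℕ → Fin N → Ω → Fin n → ℝ}
    (hθ : ∀ k, 1 ≤ k → ∀ j,
      HasLaw (θ k j) (Measure.pi fun _ : Fin n => gaussianReal 0 1) μ)
    (hind : iIndepFun (fun (p : ℕ × Fin N) => θ (p.1 + 1) p.2) μ)
    (y : Ω → ℕ → (j : Fin N) → Fin (m j) → ℝ) (i : Fin N) :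
    ∀ᵐ ω ∂μ, Tendsto (fun k => (D.stoch x₀ P₀ Y (fun k j => θ k j ω) (y ω) k).Ups i) atTop
      (𝓝 (D.Rtilde i)) := by
  have h := ae_tendsto_average_vecMulVec (θ := fun k => θ (k + 1))
    (fun k j => hθ (k + 1) (Nat.le_add_left 1 k) j) hind
    fun j => (D.L ^ D.γ) i j • (Y j)ᵀ
  have hlim : ∑ j, ((D.L ^ D.γ) i j • (Y j)ᵀ) * ((D.L ^ D.γ) i j • (Y j)ᵀ)ᵀ = D.Rtilde i := by
    refine Finset.sum_congr rfl fun j _ => ?_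
    rw [Matrix.transpose_smul, Matrix.transpose_transpose, Matrix.smul_mul, Matrix.mul_smul,
      smul_smul, hY, sq]
  rw [hlim] at h
  filter_upwards [h] with ω hω
  simpa only [stoch_Ups_eq, upsilon_eq, Matrix.smul_mulVec] using hω

end FilterData

theorem theorem1 {N n : ℕ} {m : Fin N → ℕ} (D : FilterData N n m)
    (hQ : D.Q.PosDef) (hR : ∀ i, (D.R i).PosDef)
    (G : SimpleGraph (Fin N)) (hG : G.Connected) (hL : IsConsensusWeight G D.L)
    (hγ : 1 ≤ D.γ)
    (hobs : ∀ i, Observable D.A (D.Ctilde i))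
    {Ω : Type*} [MeasurableSpace Ω] (μ : Measure Ω) [IsProbabilityMeasure μ] :
    ∀ i : Fin N, ∃ P : Matrix (Fin n) (Fin n) ℝ,
      -- `P` is the unique positive definite solution of the Riccati equation of node `i`
      (P.PosDef ∧ D.DARE i P ∧ ∀ P' : Matrix (Fin n) (Fin n) ℝ, P'.PosDef → D.DARE i P' → P' = P) ∧
      ∀ (x₀ : Fin n → ℝ) (P₀ : Matrix (Fin n) (Fin n) ℝ), P₀.PosDef →
      ∀ Y : Fin N → Matrix (Fin n) (Fin n) ℝ, (∀ j, (Y j)ᵀ * Y j = D.info j) →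
        -- direct method, row vectors `qⱼ` forming a full rank matrix
        (∀ (q : Matrix (Fin N) (Fin N) ℝ) (y : ℕ → (j : Fin N) → Fin (m j) → ℝ), q.det ≠ 0 →
          Tendsto (D.directPrior x₀ P₀ Y q y i) atTop (𝓝 P)) ∧
        -- direct method, row vectors `qⱼ` with independent standard normal entries
        (∀ (q : Ω → Matrix (Fin N) (Fin N) ℝ) (y : Ω → ℕ → (j : Fin N) → Fin (m j) → ℝ),
          (∀ j l, HasLaw (fun ω => q ω j l) (gaussianReal 0 1) μ) →
          iIndepFun (fun (p : Fin N × Fin N) ω => q ω p.1 p.2) μ →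
          ∀ᵐ ω ∂μ, Tendsto (D.directPrior x₀ P₀ Y (q ω) (y ω) i) atTop (𝓝 P)) ∧
        -- stochastic method, independent samples from `N(0, Iₙ)` at the times `k ≥ 1`
        (∀ (θ : ℕ → Fin N → Ω → Fin n → ℝ) (y : Ω → ℕ → (j : Fin N) → Fin (m j) → ℝ),
          (∀ k, 1 ≤ k → ∀ j,
            HasLaw (θ k j) (Measure.pi fun _ : Fin n => gaussianReal 0 1) μ) →
          iIndepFun (fun (p : ℕ × Fin N) => θ (p.1 + 1) p.2) μ →
          ∀ᵐ ω ∂μ, Tendsto (D.stochPrior x₀ P₀ Y (fun k j => θ k j ω) (y ω) i) atTop (𝓝 P)) := by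
  intro i
  obtain ⟨P, hP, hfix, huniq, hlim⟩ := (hobs i).exists_riccati_limit hQ
    (FilterData.Rtilde_posSemidef hR i) (FilterData.Rtilde_mul_pinv_mul_Ctilde hR i)
  refine ⟨P, ⟨hP, (FilterData.DARE_iff i P).2 hfix, fun P' hP' h =>
    huniq P' hP' ((FilterData.DARE_iff i P').1 h)⟩, fun x₀ P₀ hP₀ Y hY => ?_⟩
  have direct : ∀ (q : Matrix (Fin N) (Fin N) ℝ) (y : ℕ → (j : Fin N) → Fin (m j) → ℝ),
      q.det ≠ 0 → Tendsto (D.directPrior x₀ P₀ Y q y i) atTop (𝓝 P) := fun q y hq =>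
    hlim (fun k => D.Utilde Y q (D.direct x₀ P₀ Y q y (k + 1)).W i) _
      (fun k => FilterData.Utilde_posSemidef (FilterData.direct_W_posSemidef hL x₀ P₀ y _ i))
      (fun k => FilterData.Utilde_mul_kerProj hR hY q _ i)
      ((FilterData.tendsto_Utilde hG hL hγ x₀ P₀ hY hq y i).comp (tendsto_add_atTop_nat 1))
      (FilterData.predictCov_posDef hQ hP₀) (FilterData.directPrior_succ x₀ P₀ y i)
  refine ⟨direct, fun q y hq hind => ?_, fun θ y hθ hind => ?_⟩
  · filter_upwards [ae_det_ne_zero_of_gaussian hq hind] with ω hω using direct _ _ hω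
  · filter_upwards [FilterData.ae_tendsto_stoch_Ups x₀ P₀ hY hθ hind y i] with ω hω
    exact hlim (fun k => (D.stoch x₀ P₀ Y (fun k j => θ k j ω) (y ω) (k + 1)).Ups i) _
      (fun k => FilterData.stoch_Ups_posSemidef x₀ P₀ _ _ _ i)
      (fun k => FilterData.stoch_Ups_mul_kerProj hR hY x₀ P₀ _ _ _ i)
      (hω.comp (tendsto_add_atTop_nat 1))
      (FilterData.predictCov_posDef hQ hP₀) (FilterData.stochPrior_succ x₀ P₀ _ _ i)
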